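/- **Theorem (consistency and asymptotic normality of count SERGMs).** Fix $k$. For each $n$ let $A^n$ be a nonempty finite set of vectors $s=(s_1,\dots,s_k)$ of non-negative integers with $s_\ell\le \overline S^n_\ell$ for all $\ell$, let $\beta^n\in\mathbb R^k$, and suppose $\overline S^n_\ell\to\infty$ for every $\ell$. The *count SERGM* is the model in which the vector of network statistics $S^n$ takes the value $s\in A^n$ with probability $$\mathrm P_{\beta^n}(S^n=s)=\frac{K^n(s)\,e^{\beta^n\cdot s}}{\sum_{s'\in A^n}K^n(s')\,e^{\beta^n\cdot s'}},\qquad K^n(s)=\prod_{\ell=1}^k\binom{\overline S^n_\ell}{s_\ell}.$$ Write $p^n_\ell=e^{\beta^n_\ell}/(1+e^{\beta^n_\ell})$. Let $\mathrm P^{(\ell)}_n$ be the one-dimensional distribution on $\{0,\dots,\overline S^n_\ell\}$ with weights proportional to $\binom{\overline S^n_\ell}{j}e^{\beta^n_\ell j}$, and let $E^n_\ell$ be its mean. Assume the statistics are *non-conflicted*: there is $\varepsilon>0$ such that for all large $n$ $$\prod_\ell\{\lfloor E^n_\ell(1-\varepsilon)\rfloor,\dots,\lceil E^n_\ell(1+\varepsilon)\rceil\}\subset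 A^n .$$ A maximum likelihood estimate given $S^n=s$ is a maximizer over $\beta\in\mathbb R^k$ of $\beta\cdot s-\log\sum_{s'\in A^n}K^n(s')e^{\beta\cdot s'}$. Let $\hat\beta^n=\hat\beta^n(S^n)$ be any maximum likelihood estimator, i.e. a function of $S^n$ which is a maximum likelihood estimate whenever one exists (and is arbitrary otherwise). 1. Suppose extreme counts are negligible, that is, $\mathrm P^{(\ell)}_n(\{0\})\to0$ and $\mathrm P^{(\ell)}_n(\{\overline S^n_\ell\})\to0$ for every $\ell$. Then, with $\mathrm P_{\beta^n}$-probability tending to one, there is exactly one maximum likelihood estimate, and $|\hat\beta^n-\beta^n|\to0$ in probability. 2. If $p^n_\ell\,\overline S^n_\ell\to\infty$ for every $\ell$, then for every $\ell$ the normalized estimate $(\overline S^n_\ell)^{1/2}(\hat\beta^n_\ell-\beta^n_\ell)$ is asymptotically normal with mean $0$ and variance $\dfrac1{p^n_\ell(1-p^n_\ell)}$; that is, $$\frac{(\overline S^n_\ell)^{1/2}(\hat\beta^n_\ell-\beta^n_\ell)}{\sqrt{1/(p^n_\ell(1-p^n_\ell))}}\rightsquigarrow\mathcal N(0,1).$$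 3. Under the assumption of 1, the estimator is approximated by the direct estimator $\log\dfrac{\hat p_\ell}{1-\hat p_\ell}=\log\dfrac{S^n_\ell}{\overline S^n_\ell-S^n_\ell}$, where $\hat p_\ell=S^n_\ell/\overline S^n_\ell$: with probability tending to one $0<S^n_\ell<\overline S^n_\ell$, and the difference between $\hat\beta^n_\ell$ and the direct estimator is of smaller order in probability than the asymptotic standard deviation, $$\sqrt{\overline S^n_\ell\,p^n_\ell(1-p^n_\ell)}\;\left|\hat\beta^n_\ell-\log\frac{S^n_\ell}{\overline S^n_\ell-S^n_\ell}\right|\to0\quad\text{in probability, for every }\ell .$$ -/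

import Mathlib

open MeasureTheory ProbabilityTheory Filter Topology

noncomputable section

/-! ### Statistical exponential random graph models (SERGMs)

A vector of `k` integer-valued network statistics takes values in a finite set `A` of feasible
values.  With a weighting function `K` and a parameter vector `β`, the model draws the realized
statistics `s ∈ A` with probability proportional to `K s * exp (β · s)`. -/

/-- The linear form `β · s`. -/
def paramDot {k : ℕ} (b : EuclideanSpace ℝ (Fin k)) (s : Fin k → ℕ) : ℝ :=
  ∑ l, b l * (s l : ℝ)

/-- The normalizing sum `∑_{s ∈ A} K(s) exp(β · s)`. -/
def sergmPartition {k : ℕ} (A : Finset (Fin k → ℕ)) (K : (Fin k → ℕ) → ℝ)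
    (b : EuclideanSpace ℝ (Fin k)) : ℝ :=
  ∑ s ∈ A, K s * Real.exp (paramDot b s)

/-- The probability of the realization `s ∈ A`. -/
def sergmProb {k : ℕ} (A : Finset (Fin k → ℕ)) (K : (Fin k → ℕ) → ℝ)
    (b : EuclideanSpace ℝ (Fin k)) (s : Fin k → ℕ) : ℝ :=
  K s * Real.exp (paramDot b s) / sergmPartition A K b

/-- The law of the vector of statistics, a measure carried by `A`. -/
def sergmLaw {k : ℕ} (A : Finset (Fin k → ℕ)) (K : (Fin k → ℕ) → ℝ)
    (b : EuclideanSpace ℝ (Fin k)) : Measure (Fin k → ℕ) :=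
  ∑ s ∈ A, ENNReal.ofReal (sergmProb A K b s) • Measure.dirac s

/-- The objective maximized by the maximum likelihood estimator given the observation `s`:
`β · s - log ∑_{s' ∈ A} K(s') exp(β · s')`. -/
def sergmLogLik {k : ℕ} (A : Finset (Fin k → ℕ)) (K : (Fin k → ℕ) → ℝ)
    (s : Fin k → ℕ) (b : EuclideanSpace ℝ (Fin k)) : ℝ :=
  paramDot b s - Real.log (sergmPartition A K b)

/-! ### Count SERGMs -/

/-- The data of a count SERGM: the maximal values `Smax l` of the `k` statistics, the set `A` of
jointly feasible values (not necessarily a product set), and the parameter vector `β`. -/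
structure CountSERGM (k : ℕ) where
  Smax : Fin k → ℕ
  A : Finset (Fin k → ℕ)
  nonempty : A.Nonempty
  le_Smax : ∀ s ∈ A, ∀ l, s l ≤ Smax l
  β : EuclideanSpace ℝ (Fin k)

namespace CountSERGM

variable {k : ℕ}

/-- The weights `K(s) = ∏_l binom(Smax l, s l)` of a count SERGM. -/
def K (M : CountSERGM k) (s : Fin k → ℕ) : ℝ :=
  ∏ l, ((M.Smax l).choose (s l) : ℝ)

/-- The law of the statistics under the true parameter. -/
def law (M : CountSERGM k) : Measure (Fin k → ℕ) := sergmLaw M.A M.K M.β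

theorem weight_pos (M : CountSERGM k) (b : EuclideanSpace ℝ (Fin k)) {s : Fin k → ℕ}
    (hs : s ∈ M.A) : 0 < M.K s * Real.exp (paramDot b s) := by
  refine mul_pos (Finset.prod_pos fun l _ => ?_) (Real.exp_pos _)
  exact_mod_cast Nat.choose_pos (M.le_Smax s hs l)

theorem partition_pos (M : CountSERGM k) (b : EuclideanSpace ℝ (Fin k)) :
    0 < sergmPartition M.A M.K b :=
  Finset.sum_pos (fun _ hs => M.weight_pos b hs) M.nonempty

instance (M : CountSERGM k) : IsProbabilityMeasure M.law := by
  constructor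
  have h0 : ∀ s ∈ M.A, 0 ≤ sergmProb M.A M.K M.β s := fun s hs =>
    (div_pos (M.weight_pos M.β hs) (M.partition_pos M.β)).le
  have h1 : ∑ s ∈ M.A, sergmProb M.A M.K M.β s = 1 := by
    unfold sergmProb
    rw [← Finset.sum_div]
    exact div_self (M.partition_pos M.β).ne'
  simp only [law, sergmLaw, Measure.coe_finsetSum, Finset.sum_apply, Measure.smul_apply,
    measure_univ, smul_eq_mul, mul_one]
  rw [← ENNReal.ofReal_sum_of_nonneg h0, h1, ENNReal.ofReal_one]

/-- `b` is a maximum likelihood estimate given the observation `s`: it maximizes the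
log-likelihood over the whole parameter space. -/
def IsMLEAt (M : CountSERGM k) (s : Fin k → ℕ) (b : EuclideanSpace ℝ (Fin k)) : Prop :=
  IsMaxOn (sergmLogLik M.A M.K s) Set.univ b

/-- `est` is a maximum likelihood estimator: whenever the likelihood of a feasible observation
has a maximizer, `est` returns one; its value at other observations is arbitrary. -/
def IsMLE (M : CountSERGM k) (est : (Fin k → ℕ) → EuclideanSpace ℝ (Fin k)) : Prop :=
  ∀ s ∈ M.A, (∃ b, M.IsMLEAt s b) → M.IsMLEAt s (est s)

/-- The success probability `p_l = exp β_l / (1 + exp β_l)`. -/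
def p (M : CountSERGM k) (l : Fin k) : ℝ := Real.exp (M.β l) / (1 + Real.exp (M.β l))

/-- The one-dimensional distribution of the `l`-th statistic, ignoring the other statistics and
all cross restrictions: its range is all of `{0, …, Smax l}`. -/
def marginalProb (M : CountSERGM k) (l : Fin k) (j : ℕ) : ℝ :=
  ((M.Smax l).choose j : ℝ) * Real.exp (M.β l * j) /
    ∑ i ∈ Finset.range (M.Smax l + 1), ((M.Smax l).choose i : ℝ) * Real.exp (M.β l * i)

/-- The expectation of the `l`-th statistic under its one-dimensional distribution. -/
def marginalMean (M : CountSERGM k) (l : Fin k) : ℝ :=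
  ∑ j ∈ Finset.range (M.Smax l + 1), (j : ℝ) * M.marginalProb l j

end CountSERGM

/-- Non-conflicted statistics: for some `ε > 0` and all large `n`, the product of the integer
intervals from `⌊E_l (1 - ε)⌋` to `⌈E_l (1 + ε)⌉` is jointly feasible, where `E_l` is the
one-dimensional expectation of the `l`-th statistic. -/
def NonConflicted {k : ℕ} (M : ℕ → CountSERGM k) : Prop :=
  ∃ ε : ℝ, 0 < ε ∧ ∀ᶠ n in atTop, ∀ s : Fin k → ℕ,
    (∀ l, ⌊(M n).marginalMean l * (1 - ε)⌋ ≤ (s l : ℤ) ∧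
      (s l : ℤ) ≤ ⌈(M n).marginalMean l * (1 + ε)⌉) → s ∈ (M n).A

/-- Extreme counts are negligible: for each statistic, the one-dimensional probability of
observing the count `0` tends to zero, and so does that of observing the maximal count. -/
def ExtremesNegligible {k : ℕ} (M : ℕ → CountSERGM k) : Prop :=
  ∀ l, Tendsto (fun n => (M n).marginalProb l 0) atTop (𝓝 0) ∧
    Tendsto (fun n => (M n).marginalProb l ((M n).Smax l)) atTop (𝓝 0)

end

/-! A count SERGM is a product of independent binomials, with parameters `Smax l` and `p l`,
conditioned on the feasible set `A`. Hence the reciprocal likelihood `invLik` factors (`invLik_eq`)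
into one-dimensional binomial terms `tiltSum` times `feasMass b`, the mass that the product of
binomials with parameter `b` gives to `A`. All dependence between the statistics sits in `feasMass`.
Non-conflictedness places a relative window around the means inside `A`, so by Chebyshev `feasMass
b` is close to one for all `b` near the true parameter once the means diverge
(`HasWindow.feasMass_ge`).

The product of the `tiltSum` terms is minimized at the direct estimator and grows quadratically away
from it, with curvature comparable to the binomial variance `V` (`tiltSum_directEst_le`). On the
boundary of a box of half-width `r / √V` around the direct estimator this growth beats the small
loss in `feasMass`. As `invLik` is convex, it has a minimizer, and every minimizer lies in the box
(`HasWindow.mle_of_near`); strict convexity along feasible unit steps gives uniqueness. So the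
maximum likelihood estimate differs from the direct estimator by `o(1 / √V)`.

What remains concerns binomials. The direct estimator is linearized by expanding the logarithm on
typical counts, and the law of one statistic differs from the binomial by at most `2 * (1 -
feasMass)` against test functions bounded by one. A bound on binomial characteristic functions whose
error carries the variance, not the number of trials, then gives the normal limit even when `p`
tends to zero. Negligible extreme counts enter only by forcing the means to diverge. -/

noncomputable section

variable {k : ℕ}

/-! ### Binomial weights -/

/-- The binomial probability of `j` successes in `N` trials with success probability `p`. -/
def binomWeight (N : ℕ) (p : ℝ) (j : ℕ) : ℝ := (N.choose j : ℝ) * p ^ j * (1 - p) ^ (N - j)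

theorem binomWeight_nonneg {N : ℕ} {p : ℝ} (hp : 0 ≤ p) (hp1 : p ≤ 1) (j : ℕ) :
    0 ≤ binomWeight N p j := by
  have : 0 ≤ 1 - p := by linarith
  unfold binomWeight
  positivity

theorem eval_bernsteinPolynomial (N j : ℕ) (p : ℝ) :
    (bernsteinPolynomial ℝ N j).eval p = binomWeight N p j := by
  simp [bernsteinPolynomial, binomWeight]

theorem sum_binomWeight (N : ℕ) (p : ℝ) :
    ∑ j ∈ Finset.range (N + 1), binomWeight N p j = 1 := by
  have := congrArg (Polynomial.eval p) (bernsteinPolynomial.sum ℝ N)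
  simpa [Polynomial.eval_finsetSum, eval_bernsteinPolynomial] using this

theorem sum_mul_binomWeight (N : ℕ) (p : ℝ) :
    ∑ j ∈ Finset.range (N + 1), (j : ℝ) * binomWeight N p j = N * p := by
  have := congrArg (Polynomial.eval p) (bernsteinPolynomial.sum_smul ℝ N)
  simpa [Polynomial.eval_finsetSum, eval_bernsteinPolynomial] using this

theorem sum_sq_mul_binomWeight (N : ℕ) (p : ℝ) :
    ∑ j ∈ Finset.range (N + 1), ((j : ℝ) - N * p) ^ 2 * binomWeight N p j = N * p * (1 - p) := by
  have := congrArg (Polynomial.eval p) (bernsteinPolynomial.variance ℝ N)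
  simp only [Polynomial.eval_finsetSum, Polynomial.eval_mul, Polynomial.eval_pow,
    Polynomial.eval_sub, eval_bernsteinPolynomial, nsmul_eq_mul, Polynomial.eval_natCast,
    Polynomial.eval_X, Polynomial.eval_one] at this
  rw [← this]
  exact Finset.sum_congr rfl fun j _ => by ring

/-- Chebyshev's inequality for binomial weights. -/
theorem sum_binomWeight_le {N : ℕ} {p a : ℝ} (hp : 0 ≤ p) (hp1 : p ≤ 1) (ha : 0 < a) :
    ∑ j ∈ Finset.range (N + 1) with a ≤ |((j : ℕ) : ℝ) - N * p|, binomWeight N p j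
      ≤ N * p * (1 - p) / a ^ 2 := by
  rw [le_div_iff₀ (by positivity), ← sum_sq_mul_binomWeight N p, Finset.sum_mul]
  calc _ ≤ ∑ j ∈ Finset.range (N + 1) with a ≤ |((j : ℕ) : ℝ) - N * p|,
        ((j : ℝ) - N * p) ^ 2 * binomWeight N p j := by
        refine Finset.sum_le_sum fun j hj => ?_
        rw [mul_comm]
        have h := (Finset.mem_filter.1 hj).2
        refine mul_le_mul_of_nonneg_right ?_ (binomWeight_nonneg hp hp1 j)
        rw [← sq_abs ((j : ℝ) - N * p)]
        gcongr
    _ ≤ _ := Finset.sum_le_sum_of_subset_of_nonneg (Finset.filter_subset _ _)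
        fun j _ _ => mul_nonneg (sq_nonneg _) (binomWeight_nonneg hp hp1 j)

/-- The probability generating function of the binomial distribution. -/
theorem sum_binomWeight_mul_pow (N : ℕ) (p : ℝ) (z : ℂ) :
    ∑ j ∈ Finset.range (N + 1), (binomWeight N p j : ℂ) * z ^ j = (1 - p + p * z) ^ N := by
  rw [add_comm (1 - (p : ℂ)), add_pow]
  refine Finset.sum_congr rfl fun j _ => ?_
  simp only [binomWeight]
  push_cast
  ring

/-! ### Products of binomial weights -/

/-- The probability of `s` under a product of binomial distributions. -/
def prodBinom (N : Fin k → ℕ) (p : Fin k → ℝ) (s : Fin k → ℕ) : ℝ :=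
  ∏ l, binomWeight (N l) (p l) (s l)

/-- The range of a vector of counts with maximal values `N`. -/
def countBox (N : Fin k → ℕ) : Finset (Fin k → ℕ) :=
  Fintype.piFinset fun l => Finset.range (N l + 1)

theorem mem_countBox {N s : Fin k → ℕ} : s ∈ countBox N ↔ ∀ l, s l ≤ N l := by
  simp [countBox]

theorem prodBinom_nonneg {N : Fin k → ℕ} {p : Fin k → ℝ} (hp : ∀ l, 0 ≤ p l)
    (hp1 : ∀ l, p l ≤ 1) (s : Fin k → ℕ) : 0 ≤ prodBinom N p s :=
  Finset.prod_nonneg fun l _ => binomWeight_nonneg (hp l) (hp1 l) _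

/-- Absorbing `g` into the `i`-th factor turns the sum over the box into a product of
one-dimensional sums, of which all but the `i`-th equal one. The general semiring serves both real
weights and complex test functions. -/
theorem sum_prod_mul_apply {R : Type*} [CommSemiring R] (N : Fin k → ℕ) (f : Fin k → ℕ → R)
    (hf : ∀ l, ∑ j ∈ Finset.range (N l + 1), f l j = 1) (i : Fin k) (g : ℕ → R) :
    ∑ s ∈ countBox N, (∏ l, f l (s l)) * g (s i)
      = ∑ j ∈ Finset.range (N i + 1), f i j * g j := by
  have h1 : ∀ s : Fin k → ℕ, (∏ l, f l (s l)) * g (s i)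
      = ∏ l, (f l (s l) * if l = i then g (s l) else 1) := fun s => by
    rw [Finset.prod_mul_distrib]
    simp
  simp_rw [h1]
  rw [countBox, ← Finset.prod_univ_sum (fun l => Finset.range (N l + 1))
    (fun l j => f l j * if l = i then g j else 1), Finset.prod_eq_single i]
  · simp
  · intro l _ hl
    simp [hl, hf]
  · simp

theorem sum_prodBinom (N : Fin k → ℕ) (p : Fin k → ℝ) :
    ∑ s ∈ countBox N, prodBinom N p s = 1 := by
  unfold prodBinom countBox
  rw [← Finset.prod_univ_sum (fun l => Finset.range (N l + 1))
    (fun l j => binomWeight (N l) (p l) j)]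
  simp [sum_binomWeight]

theorem sum_prodBinom_filter (N : Fin k → ℕ) (p : Fin k → ℝ) (i : Fin k) (P : ℕ → Prop)
    [DecidablePred P] :
    ∑ s ∈ countBox N with P (s i), prodBinom N p s
      = ∑ j ∈ Finset.range (N i + 1) with P j, binomWeight (N i) (p i) j := by
  have := sum_prod_mul_apply N (fun l j => binomWeight (N l) (p l) j)
    (fun l => sum_binomWeight _ _) i (fun j => if P j then 1 else 0)
  simpa [Finset.sum_filter, prodBinom] using this

/-- Chebyshev's inequality and a union bound for products of binomial distributions. -/
theorem sum_prodBinom_le {N : Fin k → ℕ} {p a : Fin k → ℝ} (hp : ∀ l, 0 ≤ p l)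
    (hp1 : ∀ l, p l ≤ 1) (ha : ∀ l, 0 < a l) (B : Finset (Fin k → ℕ)) (hBN : B ⊆ countBox N)
    (hB : ∀ s ∈ B, ∃ l, a l ≤ |(s l : ℝ) - N l * p l|) :
    ∑ s ∈ B, prodBinom N p s ≤ ∑ l, N l * p l * (1 - p l) / a l ^ 2 := by
  have h0 := prodBinom_nonneg (N := N) hp hp1
  calc ∑ s ∈ B, prodBinom N p s
      ≤ ∑ s ∈ B, ∑ l, if a l ≤ |(s l : ℝ) - N l * p l| then prodBinom N p s else 0 := by
        refine Finset.sum_le_sum fun s hs => ?_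
        obtain ⟨l, hl⟩ := hB s hs
        refine le_trans ?_ (Finset.single_le_sum (f := fun l =>
          if a l ≤ |(s l : ℝ) - N l * p l| then prodBinom N p s else 0)
          (fun l _ => by split_ifs <;> simp [h0 s]) (Finset.mem_univ l))
        simp [hl]
    _ ≤ ∑ s ∈ countBox N, ∑ l, if a l ≤ |(s l : ℝ) - N l * p l| then prodBinom N p s else 0 :=
        Finset.sum_le_sum_of_subset_of_nonneg hBN fun s _ _ =>
          Finset.sum_nonneg fun l _ => by split_ifs <;> simp [h0 s]
    _ = ∑ l, ∑ j ∈ Finset.range (N l + 1) with a l ≤ |((j : ℕ) : ℝ) - N l * p l|,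
          binomWeight (N l) (p l) j := by
        rw [Finset.sum_comm]
        refine Finset.sum_congr rfl fun l _ => ?_
        rw [← sum_prodBinom_filter N p l (fun j => a l ≤ |((j : ℕ) : ℝ) - N l * p l|),
          Finset.sum_filter]
    _ ≤ _ := Finset.sum_le_sum fun l _ => sum_binomWeight_le (hp l) (hp1 l) (ha l)

/-- A set of counts that contains a window around the means has large mass under a product of
binomial distributions. -/
theorem one_sub_le_sum_prodBinom {N : Fin k → ℕ} {p a : Fin k → ℝ} (hp : ∀ l, 0 ≤ p l)
    (hp1 : ∀ l, p l ≤ 1) (ha : ∀ l, 0 < a l) (A : Finset (Fin k → ℕ)) (hAN : A ⊆ countBox N)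
    (hA : ∀ s ∈ countBox N, (∀ l, |(s l : ℝ) - N l * p l| < a l) → s ∈ A) :
    1 - ∑ l, N l * p l * (1 - p l) / a l ^ 2 ≤ ∑ s ∈ A, prodBinom N p s := by
  have h := sum_prodBinom_le hp hp1 ha (countBox N \ A) Finset.sdiff_subset fun s hs => by
    by_contra! hcon
    exact (Finset.mem_sdiff.1 hs).2 (hA s (Finset.mem_sdiff.1 hs).1 hcon)
  have h2 := Finset.sum_sdiff (f := prodBinom N p) hAN
  rw [sum_prodBinom] at h2
  linarith

/-! ### Localization of minimizers of convex functions -/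

/-- If the center beats the whole boundary of a box, convexity along segments from the center makes
it beat everything outside as well. A minimizer over the compact box is then global. -/
theorem exists_forall_le_of_boundary_lt {F : EuclideanSpace ℝ (Fin k) → ℝ}
    (hF : ConvexOn ℝ Set.univ F) (hc : Continuous F) (b₀ : EuclideanSpace ℝ (Fin k))
    {d : Fin k → ℝ} (hd : ∀ l, 0 < d l)
    (hlt : ∀ b : EuclideanSpace ℝ (Fin k), (∀ l, |b l - b₀ l| ≤ d l) →
      (∃ l, |b l - b₀ l| = d l) → F b₀ < F b) :
    (∃ b, ∀ b', F b ≤ F b') ∧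
      ∀ b, (∀ b', F b ≤ F b') → ∀ l, |b l - b₀ l| ≤ d l := by
  have hout : ∀ b : EuclideanSpace ℝ (Fin k), (∃ l, d l < |b l - b₀ l|) → F b₀ < F b := by
    rintro b ⟨l₀, hl₀⟩
    -- The largest ratio `g` is the gauge of `b` relative to the box; contracting towards `b₀` by `1
    -- / g` lands on the boundary, with coordinate `i` on a face.
    obtain ⟨i, hi⟩ := @Finite.exists_max (Fin k) ℝ _ ⟨l₀⟩ _ fun l => |b l - b₀ l| / d l
    have hi1 : 1 < |b i - b₀ i| / d i :=
      ((one_lt_div (hd l₀)).2 hl₀).trans_le (hi l₀)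
    set g := |b i - b₀ i| / d i with hg
    have hg0 : 0 < g := by linarith
    set t := g⁻¹ with ht
    have ht0 : 0 < t := inv_pos.2 hg0
    have ht1 : t < 1 := inv_lt_one_of_one_lt₀ hi1
    have hcoord : ∀ l, |((1 - t) • b₀ + t • b) l - b₀ l| = t * |b l - b₀ l| := fun l => by
      have : ((1 - t) • b₀ + t • b) l - b₀ l = t * (b l - b₀ l) := by
        simp only [PiLp.add_apply, PiLp.smul_apply, smul_eq_mul]
        ring
      rw [this, abs_mul, abs_of_pos ht0]
    have hbd : F b₀ < F ((1 - t) • b₀ + t • b) := by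
      refine hlt _ (fun l => ?_) ⟨i, ?_⟩
      · rw [hcoord, ht, inv_mul_le_iff₀ hg0]
        exact (div_le_iff₀ (hd l)).1 (hi l)
      · rw [hcoord, ht, inv_mul_eq_iff_eq_mul₀ hg0.ne', hg, div_mul_cancel₀ _ (hd i).ne']
    have hconv := hF.2 (Set.mem_univ b₀) (Set.mem_univ b) (by linarith : 0 ≤ 1 - t) ht0.le
      (by ring)
    simp only [smul_eq_mul] at hconv
    have : t * F b₀ < t * F b := by linarith
    exact lt_of_mul_lt_mul_left this ht0.le
  constructor
  · have hK : IsCompact ((WithLp.toLp 2 : (Fin k → ℝ) → EuclideanSpace ℝ (Fin k)) ''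
        Set.Icc (fun l => b₀ l - d l) (fun l => b₀ l + d l)) :=
      isCompact_Icc.image (PiLp.continuous_toLp 2 _)
    obtain ⟨b, -, hb⟩ := hK.exists_isMinOn (Set.Nonempty.image _ ⟨fun l => b₀ l,
      fun l => by simp [(hd l).le], fun l => by simp [(hd l).le]⟩) hc.continuousOn
    have hin : ∀ b' : EuclideanSpace ℝ (Fin k), (∀ l, |b' l - b₀ l| ≤ d l) → F b ≤ F b' :=
      fun b' hb' => hb ⟨WithLp.ofLp b', ⟨fun l => by linarith [(abs_le.1 (hb' l)).1],
        fun l => by linarith [(abs_le.1 (hb' l)).2]⟩, rfl⟩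
    refine ⟨b, fun b' => ?_⟩
    by_cases h : ∀ l, |b' l - b₀ l| ≤ d l
    · exact hin b' h
    · push Not at h
      exact (hin b₀ fun l => by simp [(hd l).le]).trans (hout b' h).le
  · intro b hb
    by_contra! h
    exact absurd (hb b₀) (not_le.2 (hout b h))

/-! ### Exponentially tilted binomial sums -/

/-- The logistic function. -/
def logistic (x : ℝ) : ℝ := Real.exp x / (1 + Real.exp x)

theorem logistic_pos (x : ℝ) : 0 < logistic x := by unfold logistic; positivity

theorem one_sub_logistic (x : ℝ) : 1 - logistic x = 1 / (1 + Real.exp x) := by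
  unfold logistic
  have : 1 + Real.exp x ≠ 0 := by positivity
  field_simp
  ring

theorem logistic_lt_one (x : ℝ) : logistic x < 1 := by
  have : 0 < 1 - logistic x := by rw [one_sub_logistic]; positivity
  linarith

/-- Exponential tilting of binomial coefficients produces binomial probabilities at the logistic
parameter, up to a factor free of `j`. -/
theorem choose_mul_exp {N j : ℕ} (hj : j ≤ N) (x : ℝ) :
    (N.choose j : ℝ) * Real.exp (x * j)
      = (1 + Real.exp x) ^ N * binomWeight N (logistic x) j := by
  have h : 1 + Real.exp x ≠ 0 := by positivity
  obtain ⟨m, rfl⟩ := Nat.exists_eq_add_of_le hj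
  rw [binomWeight, one_sub_logistic, logistic, Nat.add_sub_cancel_left, mul_comm x, Real.exp_nat_mul,
    pow_add, div_pow, div_pow, one_pow]
  field_simp

/-- The sum of the tilted weights `C(N, i) exp (x (i - j))` over `i ∈ {0, …, N}`. -/
def tiltSum (N j : ℕ) (x : ℝ) : ℝ := (1 + Real.exp x) ^ N * Real.exp (-(x * j))

theorem tiltSum_pos (N j : ℕ) (x : ℝ) : 0 < tiltSum N j x := by unfold tiltSum; positivity

theorem one_add_add_sq_div_four_le_exp {x : ℝ} (hx : |x| ≤ 1) :
    1 + x + x ^ 2 / 4 ≤ Real.exp x := by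
  -- The remainder is at most `(2/9) * |x| ^ 3`, hence at most `(2/9) * x ^ 2`, and `1/2 - 2/9`
  -- exceeds `1/4`.
  have h := Real.exp_bound hx (n := 3) (by norm_num)
  norm_num [Finset.sum_range_succ, Nat.factorial] at h
  have h1 := (abs_le.1 h).1
  have h2 : |x| ^ 3 ≤ x ^ 2 := by
    rw [← sq_abs x]
    nlinarith [abs_nonneg x, sq_nonneg |x|]
  nlinarith [sq_nonneg x]

/-- The maximum likelihood estimate of the logit of a binomial success probability given `j`
successes among `N` trials. -/
def directEst (N j : ℕ) : ℝ := Real.log ((j : ℝ) / ((N : ℝ) - j))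

/-- With `q = j / N`, the ratio of the two sums is the `N`-th power of the moment generating
function at `h` of a centered Bernoulli(`q`) variable. The linear terms cancel, so this function is
at least `1 + q * (1 - q) * h ^ 2 / 4`, and Bernoulli's inequality handles the power. -/
theorem tiltSum_directEst_le {N j : ℕ} (hj : 0 < j) (hjN : j < N) {h : ℝ} (hh : |h| ≤ 1) :
    tiltSum N j (directEst N j) * (1 + (j * ((N : ℝ) - j) / N) * h ^ 2 / 4)
      ≤ tiltSum N j (directEst N j + h) := by
  have hj' : (0 : ℝ) < j := by exact_mod_cast hj
  have hN' : (0 : ℝ) < (N : ℝ) - j := by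
    have : (j : ℝ) < N := by exact_mod_cast hjN
    linarith
  have hN : (0 : ℝ) < N := by linarith
  set x := directEst N j with hx
  have hex : Real.exp x = j / ((N : ℝ) - j) := Real.exp_log (by positivity)
  set q : ℝ := j / N with hq
  have hq0 : 0 < q := by positivity
  have hq1 : q < 1 := by rw [hq, div_lt_one hN]; linarith
  have e1 : 1 + Real.exp (x + h) = (1 + Real.exp x) * (1 - q + q * Real.exp h) := by
    rw [Real.exp_add, hex, hq]
    field_simp
    ring
  have e2 : Real.exp (-((x + h) * j)) = Real.exp (-(x * j)) * Real.exp (-(q * h)) ^ N := by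
    rw [← Real.exp_nat_mul, ← Real.exp_add]
    congr 1
    rw [hq]
    field_simp
    ring
  have e3 : (1 - q + q * Real.exp h) * Real.exp (-(q * h))
      = (1 - q) * Real.exp (-(q * h)) + q * Real.exp ((1 - q) * h) := by
    have : (1 - q) * h = h + -(q * h) := by ring
    rw [this, Real.exp_add]
    ring
  have b1 := one_add_add_sq_div_four_le_exp (x := -(q * h)) (by
    rw [abs_neg, abs_mul, abs_of_pos hq0]
    nlinarith [abs_nonneg h])
  have b2 := one_add_add_sq_div_four_le_exp (x := (1 - q) * h) (by
    rw [abs_mul, abs_of_pos (by linarith : 0 < 1 - q)]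
    nlinarith [abs_nonneg h])
  have b3 : 1 + q * (1 - q) * h ^ 2 / 4 ≤ (1 - q + q * Real.exp h) * Real.exp (-(q * h)) := by
    rw [e3]
    have := mul_le_mul_of_nonneg_left b1 (by linarith : 0 ≤ 1 - q)
    have := mul_le_mul_of_nonneg_left b2 hq0.le
    nlinarith
  have b0 : 0 ≤ q * (1 - q) * h ^ 2 / 4 := by
    have : 0 < 1 - q := by linarith
    positivity
  have b4 : 1 + (j * ((N : ℝ) - j) / N) * h ^ 2 / 4
      ≤ ((1 - q + q * Real.exp h) * Real.exp (-(q * h))) ^ N := by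
    refine le_trans ?_ (pow_le_pow_left₀ (by linarith) b3 N)
    refine le_trans (le_of_eq ?_) (one_add_mul_le_pow (by linarith) N)
    rw [hq]
    field_simp
  have e4 : tiltSum N j (x + h) = tiltSum N j x *
      ((1 - q + q * Real.exp h) * Real.exp (-(q * h))) ^ N := by
    unfold tiltSum
    rw [e1, e2, mul_pow, mul_pow]
    ring
  rw [e4]
  exact mul_le_mul_of_nonneg_left b4 (tiltSum_pos _ _ _).le

/-! ### The likelihood of a count SERGM -/

theorem paramDot_add_smul (x y : ℝ) (b c : EuclideanSpace ℝ (Fin k)) (s : Fin k → ℕ) :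
    paramDot (x • b + y • c) s = x * paramDot b s + y * paramDot c s := by
  simp only [paramDot, PiLp.add_apply, PiLp.smul_apply, smul_eq_mul, Finset.mul_sum,
    ← Finset.sum_add_distrib]
  exact Finset.sum_congr rfl fun l _ => by ring

theorem continuous_paramDot (s : Fin k → ℕ) :
    Continuous fun b : EuclideanSpace ℝ (Fin k) => paramDot b s := by
  unfold paramDot
  fun_prop

namespace CountSERGM

/-- The reciprocal of the likelihood of `s` up to a constant:
`∑_{s' ∈ A} K(s') exp(β · (s' - s))`. -/
def invLik (M : CountSERGM k) (s : Fin k → ℕ) (b : EuclideanSpace ℝ (Fin k)) : ℝ :=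
  ∑ s' ∈ M.A, M.K s' * Real.exp (paramDot b s' - paramDot b s)

theorem K_pos (M : CountSERGM k) {s : Fin k → ℕ} (hs : s ∈ M.A) : 0 < M.K s :=
  Finset.prod_pos fun l _ => by exact_mod_cast Nat.choose_pos (M.le_Smax s hs l)

theorem invLik_pos (M : CountSERGM k) (s : Fin k → ℕ) (b : EuclideanSpace ℝ (Fin k)) :
    0 < M.invLik s b :=
  Finset.sum_pos (fun _ hs => mul_pos (M.K_pos hs) (Real.exp_pos _)) M.nonempty

theorem sergmLogLik_eq (M : CountSERGM k) (s : Fin k → ℕ) (b : EuclideanSpace ℝ (Fin k)) :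
    sergmLogLik M.A M.K s b = -Real.log (M.invLik s b) := by
  have h : M.invLik s b = sergmPartition M.A M.K b * Real.exp (-paramDot b s) := by
    simp only [invLik, sergmPartition, Finset.sum_mul, sub_eq_add_neg, Real.exp_add, mul_assoc]
  rw [h, Real.log_mul (M.partition_pos b).ne' (Real.exp_pos _).ne', Real.log_exp, sergmLogLik]
  ring

theorem isMLEAt_iff (M : CountSERGM k) (s : Fin k → ℕ) (b : EuclideanSpace ℝ (Fin k)) :
    M.IsMLEAt s b ↔ ∀ b', M.invLik s b ≤ M.invLik s b' := by
  simp only [IsMLEAt, isMaxOn_iff, Set.mem_univ, true_implies, sergmLogLik_eq, neg_le_neg_iff]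
  exact forall_congr' fun b' => Real.log_le_log_iff (M.invLik_pos s b) (M.invLik_pos s b')

theorem continuous_invLik (M : CountSERGM k) (s : Fin k → ℕ) : Continuous (M.invLik s) := by
  unfold invLik
  have := continuous_paramDot (k := k)
  fun_prop

/-- A positive combination of exponentials of linear forms is convex, so the logarithm in the
likelihood need not be treated. -/
theorem convexOn_invLik (M : CountSERGM k) (s : Fin k → ℕ) :
    ConvexOn ℝ Set.univ (M.invLik s) := by
  refine ⟨convex_univ, fun b _ c _ x y hx hy hxy => ?_⟩
  simp only [invLik, smul_eq_mul, Finset.mul_sum, ← Finset.sum_add_distrib]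
  refine Finset.sum_le_sum fun s' hs' => ?_
  have h := convexOn_exp.2 (Set.mem_univ (paramDot b s' - paramDot b s))
    (Set.mem_univ (paramDot c s' - paramDot c s)) hx hy hxy
  simp only [smul_eq_mul] at h
  have h2 : paramDot (x • b + y • c) s' - paramDot (x • b + y • c) s
      = x * (paramDot b s' - paramDot b s) + y * (paramDot c s' - paramDot c s) := by
    rw [paramDot_add_smul, paramDot_add_smul]
    ring
  rw [h2]
  calc _ ≤ M.K s' * (x * Real.exp (paramDot b s' - paramDot b s) +
        y * Real.exp (paramDot c s' - paramDot c s)) :=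
        mul_le_mul_of_nonneg_left h (M.K_pos hs').le
    _ = _ := by ring

/-- If all the unit steps from `s` are feasible, the maximum likelihood estimate given `s` is
unique. -/
theorem IsMLEAt.unique {M : CountSERGM k} {s : Fin k → ℕ} {b c : EuclideanSpace ℝ (Fin k)}
    (hs : ∀ i, s + Pi.single i 1 ∈ M.A) (hb : M.IsMLEAt s b) (hc : M.IsMLEAt s c) : b = c := by
  rw [isMLEAt_iff] at hb hc
  ext i
  by_contra hne
  -- The term of a unit step in direction `i` depends on coordinate `i` of the parameter alone, so
  -- strict convexity of `exp` at `b i ≠ c i` makes the midpoint strictly better than two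
  -- minimizers.
  have hdot : ∀ x : EuclideanSpace ℝ (Fin k),
      paramDot x (s + Pi.single i 1) - paramDot x s = x i := fun x => by
    simp only [paramDot, ← Finset.sum_sub_distrib, Pi.add_apply, Nat.cast_add, Pi.single_apply]
    simp [mul_add]
  have heq : M.invLik s b = M.invLik s c := le_antisymm (hb c) (hc b)
  have hlt : M.invLik s ((1 / 2 : ℝ) • b + (1 / 2 : ℝ) • c)
      < 1 / 2 * M.invLik s b + 1 / 2 * M.invLik s c := by
    simp only [invLik, Finset.mul_sum, ← Finset.sum_add_distrib]
    have hrw : ∀ s', paramDot ((1 / 2 : ℝ) • b + (1 / 2 : ℝ) • c) s'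
        - paramDot ((1 / 2 : ℝ) • b + (1 / 2 : ℝ) • c) s
        = 1 / 2 * (paramDot b s' - paramDot b s) + 1 / 2 * (paramDot c s' - paramDot c s) :=
      fun s' => by
        rw [paramDot_add_smul, paramDot_add_smul]
        ring
    refine Finset.sum_lt_sum (fun s' hs' => ?_) ⟨s + Pi.single i 1, hs i, ?_⟩
    · have h := convexOn_exp.2 (Set.mem_univ (paramDot b s' - paramDot b s))
        (Set.mem_univ (paramDot c s' - paramDot c s)) (by norm_num : (0 : ℝ) ≤ 1 / 2)
        (by norm_num : (0 : ℝ) ≤ 1 / 2) (by norm_num)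
      simp only [smul_eq_mul] at h
      rw [hrw]
      have := mul_le_mul_of_nonneg_left h (M.K_pos hs').le
      linarith
    · have h := strictConvexOn_exp.2 (Set.mem_univ (b i)) (Set.mem_univ (c i)) hne
        (by norm_num : (0 : ℝ) < 1 / 2) (by norm_num : (0 : ℝ) < 1 / 2) (by norm_num)
      simp only [smul_eq_mul] at h
      rw [hrw, hdot, hdot]
      have := mul_lt_mul_of_pos_left h (M.K_pos (hs i))
      linarith
  have := hb ((1 / 2 : ℝ) • b + (1 / 2 : ℝ) • c)
  linarith

theorem A_subset_countBox (M : CountSERGM k) : M.A ⊆ countBox M.Smax :=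
  fun s hs => mem_countBox.2 (M.le_Smax s hs)

/-- The mass of the feasible set under the product of binomial distributions with parameter `b`. -/
def feasMass (M : CountSERGM k) (b : EuclideanSpace ℝ (Fin k)) : ℝ :=
  ∑ s ∈ M.A, prodBinom M.Smax (fun l => logistic (b l)) s

theorem feasMass_le_one (M : CountSERGM k) (b : EuclideanSpace ℝ (Fin k)) : M.feasMass b ≤ 1 := by
  rw [← sum_prodBinom M.Smax (fun l => logistic (b l))]
  exact Finset.sum_le_sum_of_subset_of_nonneg M.A_subset_countBox fun s _ _ =>
    prodBinom_nonneg (fun l => (logistic_pos _).le) (fun l => (logistic_lt_one _).le) s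

theorem K_mul_exp (M : CountSERGM k) (b : EuclideanSpace ℝ (Fin k)) {s : Fin k → ℕ}
    (hs : s ∈ countBox M.Smax) :
    M.K s * Real.exp (paramDot b s) = (∏ l, (1 + Real.exp (b l)) ^ M.Smax l) *
      prodBinom M.Smax (fun l => logistic (b l)) s := by
  rw [K, paramDot, Real.exp_sum, prodBinom, ← Finset.prod_mul_distrib, ← Finset.prod_mul_distrib]
  exact Finset.prod_congr rfl fun l _ => choose_mul_exp (mem_countBox.1 hs l) _

/-- The factorization behind the proof: without the constraint `A` the sum would split into
one-dimensional sums, and `feasMass` measures what the constraint removes. -/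
theorem invLik_eq (M : CountSERGM k) (s : Fin k → ℕ) (b : EuclideanSpace ℝ (Fin k)) :
    M.invLik s b = (∏ l, tiltSum (M.Smax l) (s l) (b l)) * M.feasMass b := by
  have h : Real.exp (-paramDot b s) = ∏ l, Real.exp (-(b l * s l)) := by
    rw [paramDot, ← Finset.sum_neg_distrib, Real.exp_sum]
  simp only [tiltSum, Finset.prod_mul_distrib, feasMass, invLik]
  rw [← h, Finset.mul_sum]
  refine Finset.sum_congr rfl fun s' hs' => ?_
  rw [sub_eq_add_neg, Real.exp_add, ← mul_assoc, M.K_mul_exp b (M.A_subset_countBox hs')]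
  ring

/-- At the direct estimator `feasMass` is bounded by one. At `b` every binomial factor has grown, so
the growth of the single factor `i` suffices if it outweighs `feasMass b`. -/
theorem invLik_lt_of_feasMass {M : CountSERGM k} {s : Fin k → ℕ}
    {b₀ b : EuclideanSpace ℝ (Fin k)} (hs : ∀ l, 0 < s l ∧ s l < M.Smax l)
    (hb₀ : ∀ l, b₀ l = directEst (M.Smax l) (s l)) (hb : ∀ l, |b l - b₀ l| ≤ 1) (i : Fin k)
    (hi : 1 < (1 + (s i * ((M.Smax i : ℝ) - s i) / M.Smax i) * (b i - b₀ i) ^ 2 / 4)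
      * M.feasMass b) :
    M.invLik s b₀ < M.invLik s b := by
  set v : Fin k → ℝ := fun l => (s l * ((M.Smax l : ℝ) - s l) / M.Smax l) * (b l - b₀ l) ^ 2 / 4
    with hv
  have hv0 : ∀ l, 0 ≤ v l := fun l => by
    have : (0 : ℝ) ≤ (M.Smax l : ℝ) - s l := by
      have : (s l : ℝ) < M.Smax l := by exact_mod_cast (hs l).2
      linarith
    simp only [hv]
    positivity
  have hT : ∀ l, tiltSum (M.Smax l) (s l) (b₀ l) * (1 + v l)
      ≤ tiltSum (M.Smax l) (s l) (b l) := fun l => by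
    have := tiltSum_directEst_le (hs l).1 (hs l).2 (hb l)
    rw [hb₀] at this ⊢
    simpa [hv, hb₀] using this
  have hZ0 : 0 < ∏ l, tiltSum (M.Smax l) (s l) (b₀ l) :=
    Finset.prod_pos fun l _ => tiltSum_pos _ _ _
  have hprod : (∏ l, tiltSum (M.Smax l) (s l) (b₀ l)) * (1 + v i)
      ≤ ∏ l, tiltSum (M.Smax l) (s l) (b l) := by
    refine le_trans ?_ (Finset.prod_le_prod (fun l _ =>
      mul_nonneg (tiltSum_pos _ _ _).le (by linarith [hv0 l])) fun l _ => hT l)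
    rw [Finset.prod_mul_distrib]
    refine mul_le_mul_of_nonneg_left ?_ hZ0.le
    rw [← Finset.mul_prod_erase _ _ (Finset.mem_univ i)]
    exact le_mul_of_one_le_right (by linarith [hv0 i])
      (Finset.one_le_prod (fun l _ => by linarith [hv0 l]) )
  have hm : 0 < M.feasMass b := by
    by_contra hcon
    have : (1 + v i) * M.feasMass b ≤ 0 :=
      mul_nonpos_of_nonneg_of_nonpos (by linarith [hv0 i]) (not_lt.1 hcon)
    simp only [hv] at this
    linarith
  rw [invLik_eq, invLik_eq]
  calc _ ≤ ∏ l, tiltSum (M.Smax l) (s l) (b₀ l) :=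
        mul_le_of_le_one_right hZ0.le (M.feasMass_le_one b₀)
    _ < (∏ l, tiltSum (M.Smax l) (s l) (b₀ l)) * ((1 + v i) * M.feasMass b) :=
        lt_mul_of_one_lt_right hZ0 hi
    _ ≤ _ := by
        rw [← mul_assoc]
        exact mul_le_mul_of_nonneg_right hprod hm.le

end CountSERGM

/-! ### A quantitative central limit theorem for binomial characteristic functions -/

theorem norm_pow_sub_pow_le_mul {a b : ℂ} (ha : ‖a‖ ≤ 1) (hb : ‖b‖ ≤ 1) (n : ℕ) :
    ‖a ^ n - b ^ n‖ ≤ n * ‖a - b‖ := by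
  induction n with
  | zero => simp
  | succ n ih =>
    have h : a ^ (n + 1) - b ^ (n + 1) = a * (a ^ n - b ^ n) + (a - b) * b ^ n := by ring
    rw [h]
    refine (norm_add_le _ _).trans ?_
    rw [norm_mul, norm_mul, norm_pow]
    have h1 : ‖a‖ * ‖a ^ n - b ^ n‖ ≤ ‖a ^ n - b ^ n‖ :=
      mul_le_of_le_one_left (norm_nonneg _) ha
    have h2 : ‖a - b‖ * ‖b‖ ^ n ≤ ‖a - b‖ :=
      mul_le_of_le_one_right (norm_nonneg _) (pow_le_one₀ (norm_nonneg _) hb)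
    push_cast
    linarith

theorem norm_cexp_mul_I_sub_taylor_two_le {y : ℝ} (hy : |y| ≤ 1) :
    ‖Complex.exp (y * Complex.I) - (1 + y * Complex.I - (y : ℂ) ^ 2 / 2)‖ ≤ |y| ^ 3 := by
  have hn : ‖(y : ℂ) * Complex.I‖ = |y| := by simp
  have h := Complex.exp_bound (x := y * Complex.I) (by rw [hn]; exact hy) (n := 3) (by norm_num)
  rw [hn] at h
  have he : ∑ m ∈ Finset.range 3, ((y : ℂ) * Complex.I) ^ m / (m.factorial : ℂ)
      = 1 + y * Complex.I - (y : ℂ) ^ 2 / 2 := by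
    simp [Finset.sum_range_succ, mul_pow, Nat.factorial]
    ring
  rw [he] at h
  refine h.trans (mul_le_of_le_one_right (by positivity) ?_)
  norm_num [Nat.factorial]

/-- The characteristic function of the centered binomial is the `N`-th power of the Bernoulli one,
`c`. Both `c` and `exp (-x)`, with `x = p * (1 - p) * τ ^ 2 / 2`, lie within `p * (1 - p) * |τ| ^ 3`
of `1 - x`; powers of numbers in the unit disc multiply the error by `N` at most. -/
theorem norm_sum_binomWeight_cexp_sub_le {N : ℕ} {p τ : ℝ} (hp : 0 ≤ p) (hp1 : p ≤ 1)
    (hτ : |τ| ≤ 1) :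
    ‖∑ j ∈ Finset.range (N + 1), (binomWeight N p j : ℂ) *
        Complex.exp ((τ * ((j : ℝ) - N * p) : ℝ) * Complex.I)
      - Complex.exp (-(N * p * (1 - p) * τ ^ 2 / 2 : ℝ))‖ ≤ 2 * (N * p * (1 - p)) * |τ| ^ 3 := by
  set c : ℂ := Complex.exp ((-(p * τ) : ℝ) * Complex.I) *
    (1 - p + p * Complex.exp (τ * Complex.I)) with hc
  have hq : 0 ≤ 1 - p := by linarith
  have hsum : ∑ j ∈ Finset.range (N + 1), (binomWeight N p j : ℂ) *
      Complex.exp ((τ * ((j : ℝ) - N * p) : ℝ) * Complex.I) = c ^ N := by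
    rw [hc, mul_pow, ← sum_binomWeight_mul_pow, Finset.mul_sum]
    refine Finset.sum_congr rfl fun j _ => ?_
    rw [← Complex.exp_nat_mul, ← Complex.exp_nat_mul, mul_left_comm, ← Complex.exp_add]
    congr 2
    push_cast
    ring
  have hc2 : c = (1 - p) * Complex.exp ((-(p * τ) : ℝ) * Complex.I)
      + p * Complex.exp (((1 - p) * τ : ℝ) * Complex.I) := by
    have : (((1 - p) * τ : ℝ) : ℂ) * Complex.I
        = (-(p * τ) : ℝ) * Complex.I + τ * Complex.I := by
      push_cast
      ring
    rw [this, Complex.exp_add, hc]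
    ring
  have np : ‖(p : ℂ)‖ = p := by rw [Complex.norm_real, Real.norm_of_nonneg hp]
  have nq : ‖(1 - p : ℂ)‖ = 1 - p := by
    have : (1 - p : ℂ) = ((1 - p : ℝ) : ℂ) := by push_cast; rfl
    rw [this, Complex.norm_real, Real.norm_of_nonneg hq]
  have hc1 : ‖c‖ ≤ 1 := by
    rw [hc2]
    refine (norm_add_le _ _).trans ?_
    rw [norm_mul, norm_mul, Complex.norm_exp_ofReal_mul_I, Complex.norm_exp_ofReal_mul_I, np, nq]
    linarith
  set x : ℝ := p * (1 - p) * τ ^ 2 / 2 with hx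
  have hx0 : 0 ≤ x := by positivity
  have hτ2 : τ ^ 2 ≤ 1 := by rw [← sq_abs]; nlinarith [abs_nonneg τ]
  have hpq : p * (1 - p) ≤ 1 := by nlinarith
  have hpq0 : 0 ≤ p * (1 - p) := by positivity
  have hx1 : x ≤ 1 := by
    have : p * (1 - p) * τ ^ 2 ≤ 1 * 1 := mul_le_mul hpq hτ2 (sq_nonneg _) zero_le_one
    linarith
  have hg : Complex.exp (-(N * p * (1 - p) * τ ^ 2 / 2 : ℝ)) = ((Real.exp (-x) : ℝ) : ℂ) ^ N := by
    rw [Complex.ofReal_exp, ← Complex.exp_nat_mul, hx]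
    congr 1
    push_cast
    ring
  have hg1 : ‖((Real.exp (-x) : ℝ) : ℂ)‖ ≤ 1 := by
    rw [Complex.norm_real, Real.norm_of_nonneg (Real.exp_pos _).le]
    exact Real.exp_le_one_iff.2 (by linarith)
  have t1 : ‖c - ((1 - x : ℝ) : ℂ)‖ ≤ p * (1 - p) * |τ| ^ 3 := by
    have h1 : |-(p * τ)| ≤ 1 := by
      rw [abs_neg, abs_mul, abs_of_nonneg hp]; nlinarith [abs_nonneg τ]
    have h2 : |(1 - p) * τ| ≤ 1 := by
      rw [abs_mul, abs_of_nonneg hq]; nlinarith [abs_nonneg τ]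
    have e1 := norm_cexp_mul_I_sub_taylor_two_le h1
    have e2 := norm_cexp_mul_I_sub_taylor_two_le h2
    have heq : c - ((1 - x : ℝ) : ℂ) = (1 - p) * (Complex.exp ((-(p * τ) : ℝ) * Complex.I)
          - (1 + (-(p * τ) : ℝ) * Complex.I - ((-(p * τ) : ℝ) : ℂ) ^ 2 / 2))
        + p * (Complex.exp (((1 - p) * τ : ℝ) * Complex.I)
          - (1 + ((1 - p) * τ : ℝ) * Complex.I - (((1 - p) * τ : ℝ) : ℂ) ^ 2 / 2)) := by
      rw [hc2, hx]
      push_cast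
      ring
    rw [heq]
    refine (norm_add_le _ _).trans ?_
    rw [norm_mul, norm_mul, np, nq]
    have f1 := mul_le_mul_of_nonneg_left e1 hq
    have f2 := mul_le_mul_of_nonneg_left e2 hp
    refine (add_le_add f1 f2).trans ?_
    rw [abs_neg, abs_mul, abs_mul, abs_of_nonneg hp, abs_of_nonneg hq, mul_pow, mul_pow]
    have hT : 0 ≤ |τ| ^ 3 := by positivity
    have : p ^ 2 + (1 - p) ^ 2 ≤ 1 := by nlinarith
    calc (1 - p) * (p ^ 3 * |τ| ^ 3) + p * ((1 - p) ^ 3 * |τ| ^ 3)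
        = (p * (1 - p) * |τ| ^ 3) * (p ^ 2 + (1 - p) ^ 2) := by ring
      _ ≤ _ := mul_le_of_le_one_right (by positivity) this
  have t2 : ‖((1 - x : ℝ) : ℂ) - ((Real.exp (-x) : ℝ) : ℂ)‖ ≤ p * (1 - p) * |τ| ^ 3 := by
    rw [← Complex.ofReal_sub, Complex.norm_real, Real.norm_eq_abs]
    have h := Real.abs_exp_sub_one_sub_id_le (x := -x) (by rw [abs_neg, abs_of_nonneg hx0]; exact hx1)
    have h3 : |1 - x - Real.exp (-x)| = |Real.exp (-x) - 1 - -x| := by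
      rw [abs_sub_comm]; congr 1; ring
    rw [h3]
    refine h.trans ?_
    have h4 : (-x) ^ 2 = p * (1 - p) * |τ| ^ 3 * (p * (1 - p) * |τ| / 4) := by
      have : τ ^ 2 = |τ| ^ 2 := (sq_abs τ).symm
      rw [hx, this]
      ring
    rw [h4]
    refine mul_le_of_le_one_right (by positivity) ?_
    have : p * (1 - p) * |τ| ≤ 1 * 1 := mul_le_mul hpq hτ (abs_nonneg _) zero_le_one
    linarith
  rw [hsum, hg]
  refine (norm_pow_sub_pow_le_mul hc1 hg1 N).trans ?_
  have t3 : ‖c - ((Real.exp (-x) : ℝ) : ℂ)‖ ≤ 2 * (p * (1 - p) * |τ| ^ 3) := by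
    have := norm_sub_le_norm_sub_add_norm_sub c ((1 - x : ℝ) : ℂ) ((Real.exp (-x) : ℝ) : ℂ)
    linarith
  calc (N : ℝ) * ‖c - ((Real.exp (-x) : ℝ) : ℂ)‖ ≤ N * (2 * (p * (1 - p) * |τ| ^ 3)) := by gcongr
    _ = _ := by ring

/-! ### Expansion of the direct estimator -/

theorem abs_log_one_add_sub_le {x : ℝ} (hx : |x| ≤ 1 / 2) : |Real.log (1 + x) - x| ≤ 2 * x ^ 2 := by
  have h := abs_le.1 hx
  have hpos : 0 < 1 + x := by linarith
  have h1 := Real.log_le_sub_one_of_pos hpos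
  have h2 := Real.one_sub_inv_le_log_of_pos hpos
  have h3 : x - 2 * x ^ 2 ≤ 1 - (1 + x)⁻¹ := by
    have : 1 - (1 + x)⁻¹ = x / (1 + x) := by field_simp; ring
    rw [this, le_div_iff₀ hpos]
    nlinarith [sq_nonneg x]
  rw [abs_le]
  constructor <;> nlinarith [sq_nonneg x]

theorem log_logit_logistic (b : ℝ) : Real.log (logistic b / (1 - logistic b)) = b := by
  rw [one_sub_logistic, logistic]
  have : 1 + Real.exp b ≠ 0 := by positivity
  rw [div_div_div_cancel_right₀ this, div_one, Real.log_exp]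

/-- First order expansion of the direct estimator around the true parameter. -/
theorem abs_directEst_sub_le {N j : ℕ} {b p x y : ℝ} (hN : 0 < N) (hp : p = logistic b)
    (hx : x = (j - N * p) / (N * p)) (hy : y = p / (1 - p)) (hx1 : |x| ≤ 1 / 2)
    (hxy : |x * y| ≤ 1 / 2) :
    0 < j ∧ j < N ∧
      |directEst N j - b - (j - N * p) / (N * p * (1 - p))| ≤ 2 * x ^ 2 * (1 + y ^ 2) := by
  have hp0 : 0 < p := hp ▸ logistic_pos b
  have hp1 : 0 < 1 - p := by have := logistic_lt_one b; rw [hp]; linarith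
  have hN0 : (0 : ℝ) < N := by exact_mod_cast hN
  -- The relative deviation of `j` is `x` and that of `N - j` is `-(x * y)`, so the log odds become
  -- a difference of two logarithms near one.
  have hj : (j : ℝ) = N * p * (1 + x) := by rw [hx]; field_simp; ring
  have hNj : (N : ℝ) - j = N * (1 - p) * (1 + -(x * y)) := by
    rw [hx, hy]; field_simp; ring
  have hx2 : 0 < 1 + x := by linarith [(abs_le.1 hx1).1]
  have hxy2 : 0 < 1 + -(x * y) := by linarith [(abs_le.1 hxy).2]
  have hj0 : (0 : ℝ) < j := by rw [hj]; positivity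
  have hNj0 : (0 : ℝ) < (N : ℝ) - j := by rw [hNj]; positivity
  refine ⟨by exact_mod_cast hj0, by exact_mod_cast (by linarith : (j : ℝ) < N), ?_⟩
  have hd : directEst N j = b + Real.log (1 + x) - Real.log (1 + -(x * y)) := by
    have h1 : (j : ℝ) / ((N : ℝ) - j) = p / (1 - p) * ((1 + x) / (1 + -(x * y))) := by
      rw [hNj, hj]; field_simp
    rw [directEst, h1, Real.log_mul (by positivity) (by positivity),
      Real.log_div hx2.ne' hxy2.ne', hp, log_logit_logistic]
    ring
  have hlin : ((j : ℝ) - N * p) / (N * p * (1 - p)) = x + x * y := by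
    rw [hx, hy]; field_simp; ring
  rw [hd, hlin]
  have l1 := abs_log_one_add_sub_le hx1
  have l2 := abs_log_one_add_sub_le (x := -(x * y)) (by rwa [abs_neg])
  have : b + Real.log (1 + x) - Real.log (1 + -(x * y)) - b - (x + x * y)
      = (Real.log (1 + x) - x) - (Real.log (1 + -(x * y)) - -(x * y)) := by ring
  rw [this]
  refine (abs_sub _ _).trans ((add_le_add l1 l2).trans (le_of_eq (by ring)))

/-- The bound is relative to `logistic b`, so that it remains useful when the success probability is
tiny. -/
theorem abs_logistic_sub_le {b c θ : ℝ} (hθ : θ ≤ 1) (h : |c - b| ≤ θ) :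
    |logistic c - logistic b| ≤ 2 * θ * logistic b := by
  have hθ0 : 0 ≤ θ := (abs_nonneg _).trans h
  have hb : 0 < 1 + Real.exp b := by positivity
  have hcpos : 0 < 1 + Real.exp c := by positivity
  have key : logistic c - logistic b = logistic b * ((Real.exp (c - b) - 1) / (1 + Real.exp c)) := by
    have : Real.exp c = Real.exp b * Real.exp (c - b) := by rw [← Real.exp_add]; congr 1; ring
    unfold logistic
    rw [this] at hcpos ⊢
    field_simp
    ring
  have h1 : |Real.exp (c - b) - 1| ≤ 2 * |c - b| :=
    Real.abs_exp_sub_one_le (h.trans hθ)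
  rw [key, abs_mul, abs_of_pos (logistic_pos b), mul_comm]
  refine mul_le_mul_of_nonneg_right ?_ (logistic_pos b).le
  rw [abs_div, abs_of_pos hcpos]
  refine (div_le_self (abs_nonneg _) (by linarith [Real.exp_pos c])).trans ?_
  linarith

/-! ### Nonasymptotic control of the maximum likelihood estimate -/

namespace CountSERGM

/-- The mean of the `l`-th statistic under its one-dimensional binomial distribution. -/
def binMean (M : CountSERGM k) (l : Fin k) : ℝ := M.Smax l * M.p l

/-- The variance of the `l`-th statistic under its one-dimensional binomial distribution. -/
def binVar (M : CountSERGM k) (l : Fin k) : ℝ := M.Smax l * M.p l * (1 - M.p l)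

theorem p_eq (M : CountSERGM k) (l : Fin k) : M.p l = logistic (M.β l) := rfl

theorem p_pos (M : CountSERGM k) (l : Fin k) : 0 < M.p l := logistic_pos _

theorem p_lt_one (M : CountSERGM k) (l : Fin k) : M.p l < 1 := logistic_lt_one _

/-- The feasible set contains a relative window of size `ε` around the binomial means, and this
window is compatible with the maximal counts. -/
structure HasWindow (M : CountSERGM k) (ε : ℝ) : Prop where
  pos : 0 < ε
  le_half : ε ≤ 1 / 2
  mean_pos : ∀ l, 0 < M.binMean l
  mean_le : ∀ l, M.binMean l * (1 + ε) ≤ M.Smax l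
  mem : ∀ s : Fin k → ℕ, (∀ l, |(s l : ℝ) - M.binMean l| ≤ ε * M.binMean l) → s ∈ M.A

namespace HasWindow

variable {M : CountSERGM k} {ε : ℝ}

theorem Smax_pos (h : M.HasWindow ε) (l : Fin k) : (0 : ℝ) < M.Smax l := by
  have h1 := h.mean_pos l
  have h2 := M.p_pos l
  unfold binMean at h1
  exact pos_of_mul_pos_left h1 h2.le

/-- The upper end of the window fits below the maximal count, which keeps `p` away from one and
makes variance and mean comparable. -/
theorem eps_mul_p_le (h : M.HasWindow ε) (l : Fin k) : ε * M.p l ≤ 1 - M.p l := by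
  have h1 := h.mean_le l
  have h2 := h.Smax_pos l
  unfold binMean at h1
  have : (M.Smax l : ℝ) * (M.p l * (1 + ε)) ≤ M.Smax l * 1 := by linarith
  have := le_of_mul_le_mul_left this h2
  linarith

theorem half_eps_le (h : M.HasWindow ε) (l : Fin k) : ε / 2 ≤ 1 - M.p l := by
  have := h.eps_mul_p_le l
  have h1 := h.pos
  have h2 := h.le_half
  nlinarith [M.p_pos l]

theorem var_le (h : M.HasWindow ε) (l : Fin k) : M.binVar l ≤ M.binMean l :=
  mul_le_of_le_one_right (h.mean_pos l).le (by linarith [M.p_pos l])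

theorem le_var (h : M.HasWindow ε) (l : Fin k) : ε / 2 * M.binMean l ≤ M.binVar l := by
  have := mul_le_mul_of_nonneg_left (h.half_eps_le l) (h.mean_pos l).le
  unfold binVar
  unfold binMean at this ⊢
  linarith

theorem var_pos (h : M.HasWindow ε) (l : Fin k) : 0 < M.binVar l :=
  lt_of_lt_of_le (mul_pos (by linarith [h.pos]) (h.mean_pos l)) (h.le_var l)

/-- Moving the parameter by `ε / 4` moves each mean by at most a fraction `ε / 2`, so half of the
window still surrounds the new means. Chebyshev with variance at most `2 * binMean` and deviation `ε
/ 2 * binMean` gives the constant `8 / ε ^ 2`. -/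
theorem feasMass_ge (h : M.HasWindow ε) {b : EuclideanSpace ℝ (Fin k)}
    (hb : ∀ l, |b l - M.β l| ≤ ε / 4) :
    1 - ∑ l, 8 / (ε ^ 2 * M.binMean l) ≤ M.feasMass b := by
  have hε := h.pos
  have hε2 := h.le_half
  have hσ : ∀ l, |logistic (b l) - M.p l| ≤ ε / 2 * M.p l := fun l => by
    have := abs_logistic_sub_le (by linarith) (hb l)
    rw [p_eq]
    linarith
  have hm : ∀ l, |M.Smax l * logistic (b l) - M.binMean l| ≤ ε / 2 * M.binMean l := fun l => by
    have := mul_le_mul_of_nonneg_left (hσ l) (h.Smax_pos l).le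
    unfold binMean
    rw [← mul_sub, abs_mul, abs_of_pos (h.Smax_pos l)]
    linarith
  have h1 := one_sub_le_sum_prodBinom (N := M.Smax) (p := fun l => logistic (b l))
    (a := fun l => ε / 2 * M.binMean l) (fun l => (logistic_pos _).le)
    (fun l => (logistic_lt_one _).le) (fun l => mul_pos (by linarith) (h.mean_pos l)) M.A
    M.A_subset_countBox fun s _ hs => h.mem s fun l => by
      have h1 := abs_sub_le (s l : ℝ) (M.Smax l * logistic (b l)) (M.binMean l)
      linarith [hs l, hm l]
  refine le_trans ?_ h1
  refine sub_le_sub_left (Finset.sum_le_sum fun l _ => ?_) 1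
  have hE := h.mean_pos l
  have hle : (M.Smax l : ℝ) * logistic (b l) * (1 - logistic (b l)) ≤ 2 * M.binMean l := by
    have h3 : (0 : ℝ) ≤ M.Smax l * logistic (b l) :=
      mul_nonneg (h.Smax_pos l).le (logistic_pos _).le
    have h4 := mul_le_of_le_one_right h3 (by linarith [logistic_pos (b l)] : 1 - logistic (b l) ≤ 1)
    have h5 := (abs_le.1 (hm l)).2
    nlinarith
  rw [div_le_div_iff₀ (by positivity) (by positivity)]
  calc _ ≤ 2 * M.binMean l * (ε ^ 2 * M.binMean l) := by gcongr
    _ = _ := by ring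

/-- On the boundary of the box of half-width `r / √V` the binomial factor grows by at least `1 + r ^
2 / 16`, while `feasMass` is at least `1 - r ^ 2 / 32`; their product exceeds one. -/
theorem mle_of_near (h : M.HasWindow ε) {s : Fin k → ℕ} {r : ℝ} (hr : 0 < r) (hr1 : r ≤ 1)
    (hE : ∀ l, 2 ≤ ε * M.binMean l) (hsum : ∑ l, 8 / (ε ^ 2 * M.binMean l) ≤ r ^ 2 / 32)
    (hd : ∀ l, r / √(M.binVar l) ≤ ε / 8) (hs0 : ∀ l, 0 < s l ∧ s l < M.Smax l)
    (hs : ∀ l, |(s l : ℝ) - M.binMean l| ≤ ε / 8 * M.binMean l)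
    (hdir : ∀ l, |directEst (M.Smax l) (s l) - M.β l| ≤ ε / 8) :
    (∃! b, M.IsMLEAt s b) ∧ ∀ b, M.IsMLEAt s b → ∀ l,
      √(M.binVar l) * |b l - directEst (M.Smax l) (s l)| ≤ r := by
  have hε := h.pos
  have hε2 := h.le_half
  set b₀ : EuclideanSpace ℝ (Fin k) :=
    WithLp.toLp 2 fun l => directEst (M.Smax l) (s l) with hb₀
  have hsq : ∀ l, 0 < √(M.binVar l) := fun l => Real.sqrt_pos.2 (h.var_pos l)
  -- Near the mean both the count and its complement are at least half of their expectations, so a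
  -- quarter of the variance survives as curvature.
  have hv : ∀ l, M.binVar l / 4 ≤ s l * ((M.Smax l : ℝ) - s l) / M.Smax l := fun l => by
    have hN := h.Smax_pos l
    have hE0 := h.mean_pos l
    have h1 := abs_le.1 (hs l)
    have h2 : M.binMean l / 2 ≤ s l := by nlinarith
    have h3 : (M.Smax l : ℝ) * (1 - M.p l) / 2 ≤ (M.Smax l : ℝ) - s l := by
      have h4 := h.mean_le l
      have : (M.Smax l : ℝ) * (1 - M.p l) = M.Smax l - M.binMean l := by unfold binMean; ring
      rw [this]
      nlinarith
    have hp1 := M.p_lt_one l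
    rw [le_div_iff₀ hN]
    calc M.binVar l / 4 * M.Smax l
        = M.binMean l / 2 * ((M.Smax l : ℝ) * (1 - M.p l) / 2) := by
          unfold binVar binMean; ring
      _ ≤ _ := mul_le_mul h2 h3 (by have : 0 < 1 - M.p l := by linarith
                                    positivity) (by positivity)
  have hmain := exists_forall_le_of_boundary_lt (M.convexOn_invLik s) (M.continuous_invLik s) b₀
    (d := fun l => r / √(M.binVar l)) (fun l => div_pos hr (hsq l)) (by
      rintro b hb ⟨i, hi⟩
      refine invLik_lt_of_feasMass hs0 (fun l => rfl) (fun l => (hb l).trans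
        ((hd l).trans (by linarith))) i ?_
      have hmass := h.feasMass_ge (b := b) fun l => by
        have h1 := abs_sub_le (b l) (b₀ l) (M.β l)
        have h2 := hb l
        have h3 := hdir l
        have h4 := hd l
        have h5 : b₀ l = directEst (M.Smax l) (s l) := rfl
        rw [← h5] at h3
        simp only at h2
        linarith
      have hdd : (b i - b₀ i) ^ 2 = r ^ 2 / M.binVar i := by
        rw [← sq_abs, hi, div_pow, Real.sq_sqrt (h.var_pos i).le]
      have hx : r ^ 2 / 16 ≤ s i * ((M.Smax i : ℝ) - s i) / M.Smax i * (b i - b₀ i) ^ 2 / 4 := by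
        rw [hdd]
        have := mul_le_mul_of_nonneg_right (hv i)
          (div_pos (pow_pos hr 2) (h.var_pos i)).le
        have h6 : M.binVar i / 4 * (r ^ 2 / M.binVar i) = r ^ 2 / 4 := by
          have := (h.var_pos i).ne'
          field_simp
        linarith
      have hr2 : 0 < r ^ 2 := by positivity
      have hr21 : r ^ 2 ≤ 1 := by nlinarith
      calc (1 : ℝ) < (1 + r ^ 2 / 16) * (1 - r ^ 2 / 32) := by nlinarith
        _ ≤ _ := mul_le_mul (by linarith) (by linarith) (by linarith) (by linarith))
  obtain ⟨⟨b, hb⟩, hloc⟩ := hmain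
  have hunit : ∀ i, s + Pi.single i 1 ∈ M.A := fun i => h.mem _ fun l => by
    have h1 := abs_le.1 (hs l)
    have h2 := hE l
    have h3 : ((s + Pi.single i 1 : Fin k → ℕ) l : ℝ) = s l + if l = i then 1 else 0 := by
      simp [Pi.single_apply]
    rw [h3, abs_le]
    split_ifs <;> constructor <;> linarith
  refine ⟨⟨b, (M.isMLEAt_iff s b).2 hb, fun c hc =>
    hc.unique hunit ((M.isMLEAt_iff s b).2 hb)⟩, fun c hc l => ?_⟩
  have := hloc c ((M.isMLEAt_iff s c).1 hc) l
  rwa [le_div_iff₀ (hsq l), mul_comm] at this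

end HasWindow

end CountSERGM

namespace CountSERGM

/-! ### The law of a count SERGM -/

theorem feasMass_pos (M : CountSERGM k) (b : EuclideanSpace ℝ (Fin k)) : 0 < M.feasMass b := by
  refine Finset.sum_pos (fun s hs => Finset.prod_pos fun l _ => ?_) M.nonempty
  have h1 : (0 : ℝ) < (M.Smax l).choose (s l) := by
    exact_mod_cast Nat.choose_pos (M.le_Smax s hs l)
  have h2 := logistic_pos (b l)
  have h3 : 0 < 1 - logistic (b l) := by linarith [logistic_lt_one (b l)]
  unfold binomWeight
  positivity

theorem sergmProb_eq (M : CountSERGM k) {s : Fin k → ℕ} (hs : s ∈ M.A) :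
    sergmProb M.A M.K M.β s
      = prodBinom M.Smax (fun l => logistic (M.β l)) s / M.feasMass M.β := by
  have hZ : (∏ l, (1 + Real.exp (M.β l)) ^ M.Smax l) ≠ 0 :=
    (Finset.prod_pos fun l _ => by positivity).ne'
  have hpart : sergmPartition M.A M.K M.β
      = (∏ l, (1 + Real.exp (M.β l)) ^ M.Smax l) * M.feasMass M.β := by
    rw [sergmPartition, feasMass, Finset.mul_sum]
    exact Finset.sum_congr rfl fun s hs => M.K_mul_exp _ (M.A_subset_countBox hs)
  rw [sergmProb, hpart, M.K_mul_exp _ (M.A_subset_countBox hs), mul_div_mul_left _ _ hZ]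

theorem sergmProb_nonneg (M : CountSERGM k) {s : Fin k → ℕ} (hs : s ∈ M.A) :
    0 ≤ sergmProb M.A M.K M.β s :=
  (div_pos (M.weight_pos M.β hs) (M.partition_pos M.β)).le

theorem integral_law (M : CountSERGM k) (f : (Fin k → ℕ) → ℂ) :
    ∫ s, f s ∂M.law = ∑ s ∈ M.A, (sergmProb M.A M.K M.β s : ℂ) * f s := by
  rw [law, sergmLaw, integral_finsetSum_measure]
  · refine Finset.sum_congr rfl fun s hs => ?_
    rw [integral_smul_measure, integral_dirac, ENNReal.toReal_ofReal (M.sergmProb_nonneg hs)]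
    simp
  · intro s _
    exact (integrable_dirac (by simp)).smul_measure ENNReal.ofReal_ne_top

theorem law_apply (M : CountSERGM k) (B : Set (Fin k → ℕ)) [DecidablePred (· ∈ B)] :
    M.law B = ENNReal.ofReal (∑ s ∈ M.A with s ∈ B, sergmProb M.A M.K M.β s) := by
  rw [ENNReal.ofReal_sum_of_nonneg fun s hs => M.sergmProb_nonneg (Finset.mem_filter.1 hs).1,
    Finset.sum_filter, law, sergmLaw, Measure.coe_finsetSum, Finset.sum_apply]
  refine Finset.sum_congr rfl fun s _ => ?_
  rw [Measure.smul_apply, Measure.dirac_apply' _ .of_discrete]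
  by_cases h : s ∈ B <;> simp [h]

/-- The law of one statistic is close to the binomial distribution. -/
theorem norm_integral_law_sub_le (M : CountSERGM k) (l : Fin k) {g : ℕ → ℂ}
    (hg : ∀ j, ‖g j‖ ≤ 1) :
    ‖∫ s, g (s l) ∂M.law - ∑ j ∈ Finset.range (M.Smax l + 1),
      (binomWeight (M.Smax l) (M.p l) j : ℂ) * g j‖ ≤ 2 * (1 - M.feasMass M.β) := by
  set w := prodBinom M.Smax (fun l => logistic (M.β l)) with hw
  have hw0 : ∀ s, 0 ≤ w s :=
    prodBinom_nonneg (fun l => (logistic_pos _).le) (fun l => (logistic_lt_one _).le)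
  have hm := M.feasMass_pos M.β
  have hm1 := M.feasMass_le_one M.β
  have hbox : ∑ j ∈ Finset.range (M.Smax l + 1), (binomWeight (M.Smax l) (M.p l) j : ℂ) * g j
      = ∑ s ∈ countBox M.Smax, (w s : ℂ) * g (s l) := by
    rw [← sum_prod_mul_apply M.Smax (fun l j => (binomWeight (M.Smax l) (M.p l) j : ℂ))
      (fun l => by exact_mod_cast sum_binomWeight (M.Smax l) (M.p l)) l g]
    refine Finset.sum_congr rfl fun s _ => ?_
    rw [hw, prodBinom]
    push_cast
    rfl
  have hcompl : ∑ s ∈ countBox M.Smax \ M.A, w s = 1 - M.feasMass M.β := by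
    have h := Finset.sum_sdiff (f := w) M.A_subset_countBox
    rw [hw, sum_prodBinom] at h
    rw [hw]
    simp only [feasMass]
    linarith
  have hprob : ∑ s ∈ M.A, (w s / M.feasMass M.β - w s) = 1 - M.feasMass M.β := by
    rw [Finset.sum_sub_distrib, ← Finset.sum_div]
    change M.feasMass M.β / M.feasMass M.β - M.feasMass M.β = _
    rw [div_self hm.ne']
  have hterm : ∀ (a : ℝ) (s : Fin k → ℕ), 0 ≤ a → ‖(a : ℂ) * g (s l)‖ ≤ a := fun a s ha => by
    rw [norm_mul, Complex.norm_real, Real.norm_of_nonneg ha]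
    exact mul_le_of_le_one_right ha (hg _)
  -- On `A` conditioning only raises the weights, by `1 - feasMass` in total; the weights outside
  -- `A` also sum to `1 - feasMass`.
  rw [integral_law, hbox, ← Finset.sum_sdiff (f := fun s => (w s : ℂ) * g (s l))
    M.A_subset_countBox, add_comm, sub_add_eq_sub_sub, ← Finset.sum_sub_distrib]
  refine (norm_sub_le _ _).trans ?_
  have h1 : ‖∑ s ∈ M.A, ((sergmProb M.A M.K M.β s : ℂ) * g (s l) - (w s : ℂ) * g (s l))‖
      ≤ 1 - M.feasMass M.β := by
    rw [← hprob]
    refine norm_sum_le_of_le _ fun s hs => ?_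
    rw [← sub_mul, ← Complex.ofReal_sub, M.sergmProb_eq hs]
    refine hterm _ s ?_
    rw [sub_nonneg]
    exact le_div_self (hw0 s) hm hm1
  have h2 : ‖∑ s ∈ countBox M.Smax \ M.A, (w s : ℂ) * g (s l)‖ ≤ 1 - M.feasMass M.β := by
    rw [← hcompl]
    exact norm_sum_le_of_le _ fun s _ => hterm _ s (hw0 s)
  linarith

/-- The sixth root of the binomial mean. -/
def scale (M : CountSERGM k) (l : Fin k) : ℝ := M.binMean l ^ (1 / 6 : ℝ)

/-- The vectors of counts whose deviations from the binomial means are of smaller order than the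
power `2 / 3` of these means. -/
def typical (M : CountSERGM k) : Set (Fin k → ℕ) :=
  {s | ∀ l, |(s l : ℝ) - M.binMean l| < M.scale l ^ 4}

theorem binMean_eq_scale (M : CountSERGM k) (l : Fin k) : M.binMean l = M.scale l ^ 6 := by
  have : 0 ≤ M.binMean l := mul_nonneg (Nat.cast_nonneg _) (M.p_pos l).le
  rw [scale, ← Real.rpow_natCast, ← Real.rpow_mul this]
  norm_num

/-- With `u = scale`, Chebyshev gives `u ^ 6 / u ^ 8`. The exponent `2 / 3` lies above `1 / 2`, as
needed here, and below `3 / 4`, as needed for the quadratic remainder of the direct estimator. -/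
theorem law_typical_compl_le (M : CountSERGM k) (hE : ∀ l, 0 < M.binMean l) :
    M.law M.typicalᶜ ≤ ENNReal.ofReal ((∑ l, 1 / M.scale l ^ 2) / M.feasMass M.β) := by
  classical
  have hu : ∀ l, 0 < M.scale l := fun l => Real.rpow_pos_of_pos (hE l) _
  rw [law_apply]
  refine ENNReal.ofReal_le_ofReal ?_
  rw [Finset.sum_congr rfl fun s hs => M.sergmProb_eq (Finset.mem_filter.1 hs).1,
    ← Finset.sum_div]
  refine div_le_div_of_nonneg_right ?_ (M.feasMass_pos _).le
  refine (sum_prodBinom_le (a := fun l => M.scale l ^ 4) (fun l => (logistic_pos _).le)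
    (fun l => (logistic_lt_one _).le) (fun l => pow_pos (hu l) 4) _
    ((Finset.filter_subset _ _).trans M.A_subset_countBox) fun s hs => ?_).trans
    (Finset.sum_le_sum fun l _ => ?_)
  · have := (Finset.mem_filter.1 hs).2
    simpa [typical, binMean, p_eq] using this
  · change M.binVar l / (M.scale l ^ 4) ^ 2 ≤ _
    have h1 : M.binVar l ≤ M.scale l ^ 6 := by
      rw [← binMean_eq_scale]
      exact mul_le_of_le_one_right (hE l).le (by linarith [M.p_pos l])
    have := hu l
    rw [div_le_div_iff₀ (by positivity) (by positivity)]
    calc M.binVar l * M.scale l ^ 2 ≤ M.scale l ^ 6 * M.scale l ^ 2 := by gcongr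
      _ = _ := by ring

/-- The direct estimator is close to the true parameter for typical counts. -/
theorem HasWindow.directEst_near {M : CountSERGM k} {ε : ℝ} (h : M.HasWindow ε) {l : Fin k} {j : ℕ}
    (hu1 : 1 ≤ M.scale l) (hu : 8 / ε ≤ M.scale l ^ 2)
    (hj : |(j : ℝ) - M.binMean l| < M.scale l ^ 4) :
    |(j : ℝ) - M.binMean l| ≤ ε / 8 * M.binMean l ∧ 0 < j ∧ j < M.Smax l ∧
      |directEst (M.Smax l) j - M.β l| ≤ (2 * (1 + 1 / ε ^ 2) + 2 / ε) / M.scale l ∧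
      |√(M.binVar l) * (directEst (M.Smax l) j - M.β l)
        - ((j : ℝ) - M.binMean l) / √(M.binVar l)|
          ≤ (2 * (1 + 1 / ε ^ 2) + 2 / ε) / M.scale l := by
  have hε := h.pos
  have hε2 := h.le_half
  have hE := h.mean_pos l
  set u := M.scale l with hudef
  have hu0 : 0 < u := by linarith
  have hEu : M.binMean l = u ^ 6 := M.binMean_eq_scale l
  have hp0 := M.p_pos l
  have hp1 : 0 < 1 - M.p l := by linarith [M.p_lt_one l]
  have hV := h.var_pos l
  have hεu : 8 ≤ ε * u ^ 2 := by rwa [div_le_iff₀' hε] at hu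
  have hrel : |(j : ℝ) - M.binMean l| ≤ ε / 8 * M.binMean l := by
    refine hj.le.trans ?_
    rw [hEu]
    have : 0 ≤ u ^ 4 := by positivity
    nlinarith
  set x : ℝ := (j - M.Smax l * M.p l) / (M.Smax l * M.p l) with hx
  set y : ℝ := M.p l / (1 - M.p l) with hy
  have hxE : x = (j - M.binMean l) / M.binMean l := rfl
  have hxu : |x| ≤ 1 / u ^ 2 := by
    rw [hxE, abs_div, abs_of_pos hE, div_le_div_iff₀ hE (by positivity), hEu]
    have : |(j : ℝ) - u ^ 6| ≤ u ^ 4 := by rw [← hEu]; exact hj.le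
    calc |(j : ℝ) - u ^ 6| * u ^ 2 ≤ u ^ 4 * u ^ 2 := by gcongr
      _ = _ := by ring
  have hxε : |x| ≤ ε / 8 := by
    rw [hxE, abs_div, abs_of_pos hE, div_le_iff₀ hE]
    exact hrel
  have hy0 : 0 ≤ y := by positivity
  have hyε : y ≤ 1 / ε := by
    rw [hy, div_le_div_iff₀ hp1 hε]
    linarith [h.eps_mul_p_le l]
  have hxy : |x * y| ≤ 1 / 2 := by
    rw [abs_mul, abs_of_nonneg hy0]
    calc |x| * y ≤ ε / 8 * (1 / ε) := by gcongr
      _ = 1 / 8 := by field_simp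
      _ ≤ _ := by norm_num
  obtain ⟨h1, h2, h3⟩ := abs_directEst_sub_le (N := M.Smax l) (j := j) (by exact_mod_cast h.Smax_pos l)
    (M.p_eq l) hx hy (hxε.trans (by linarith)) hxy
  change |directEst (M.Smax l) j - M.β l - ((j : ℝ) - M.binMean l) / M.binVar l| ≤ _ at h3
  set D := directEst (M.Smax l) j - M.β l
  have hR : |D - ((j : ℝ) - M.binMean l) / M.binVar l| ≤ 2 * (1 + 1 / ε ^ 2) / u ^ 4 := by
    refine h3.trans ?_
    have hx2 : x ^ 2 ≤ 1 / u ^ 4 := by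
      rw [← sq_abs]
      calc |x| ^ 2 ≤ (1 / u ^ 2) ^ 2 := by gcongr
        _ = _ := by field_simp
    have hy2 : y ^ 2 ≤ 1 / ε ^ 2 := by
      calc y ^ 2 ≤ (1 / ε) ^ 2 := by gcongr
        _ = _ := by field_simp
    calc 2 * x ^ 2 * (1 + y ^ 2) ≤ 2 * (1 / u ^ 4) * (1 + 1 / ε ^ 2) := by gcongr
      _ = _ := by ring
  refine ⟨hrel, h1, h2, ?_, ?_⟩
  · have hlin : |((j : ℝ) - M.binMean l) / M.binVar l| ≤ 2 / ε / u := by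
      rw [abs_div, abs_of_pos hV, div_div, div_le_div_iff₀ hV (by positivity)]
      have hVle := h.le_var l
      rw [hEu] at hVle
      calc |(j : ℝ) - M.binMean l| * (ε * u) ≤ u ^ 4 * (ε * u) := by gcongr
        _ = ε * u ^ 5 := by ring
        _ ≤ ε * u ^ 6 := by gcongr; norm_num
        _ = 2 * (ε / 2 * u ^ 6) := by ring
        _ ≤ _ := by gcongr
    have hR' : 2 * (1 + 1 / ε ^ 2) / u ^ 4 ≤ 2 * (1 + 1 / ε ^ 2) / u := by
      gcongr
      exact le_self_pow₀ hu1 (by norm_num)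
    have := abs_add_le (D - ((j : ℝ) - M.binMean l) / M.binVar l)
      (((j : ℝ) - M.binMean l) / M.binVar l)
    rw [sub_add_cancel] at this
    rw [add_div]
    linarith
  · have hsq : 0 < √(M.binVar l) := Real.sqrt_pos.2 hV
    have heq : √(M.binVar l) * D - ((j : ℝ) - M.binMean l) / √(M.binVar l)
        = √(M.binVar l) * (D - ((j : ℝ) - M.binMean l) / M.binVar l) := by
      have : ((j : ℝ) - M.binMean l) / √(M.binVar l)
          = √(M.binVar l) * (((j : ℝ) - M.binMean l) / M.binVar l) := by
        rw [div_eq_iff hsq.ne', mul_right_comm, Real.mul_self_sqrt hV.le]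
        field_simp
      rw [this]
      ring
    rw [heq, abs_mul, abs_of_pos hsq]
    -- The remainder of order `u ^ (-4)` times a standard deviation of order at most `u ^ 3` leaves
    -- `1 / u`.
    have hsu : √(M.binVar l) ≤ u ^ 3 := by
      rw [Real.sqrt_le_left (by positivity)]
      refine (h.var_le l).trans (le_of_eq ?_)
      rw [hEu]
      ring
    calc _ ≤ u ^ 3 * (2 * (1 + 1 / ε ^ 2) / u ^ 4) := by gcongr
      _ = 2 * (1 + 1 / ε ^ 2) / u := by field_simp
      _ ≤ _ := by
        gcongr
        have : 0 ≤ 2 / ε := by positivity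
        linarith

/-! ### One-dimensional distributions -/

theorem marginalProb_eq (M : CountSERGM k) (l : Fin k) {j : ℕ} (hj : j ≤ M.Smax l) :
    M.marginalProb l j = binomWeight (M.Smax l) (M.p l) j := by
  have hden : ∑ i ∈ Finset.range (M.Smax l + 1), ((M.Smax l).choose i : ℝ) * Real.exp (M.β l * i)
      = (1 + Real.exp (M.β l)) ^ M.Smax l := by
    rw [Finset.sum_congr rfl fun i hi =>
      choose_mul_exp (Nat.lt_succ_iff.1 (Finset.mem_range.1 hi)) (M.β l), ← Finset.mul_sum,
      sum_binomWeight, mul_one]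
  have : (1 + Real.exp (M.β l)) ^ M.Smax l ≠ 0 := by positivity
  rw [marginalProb, hden, choose_mul_exp hj, mul_div_cancel_left₀ _ this, p_eq]

theorem marginalMean_eq (M : CountSERGM k) (l : Fin k) : M.marginalMean l = M.binMean l := by
  rw [marginalMean, binMean, ← sum_mul_binomWeight]
  exact Finset.sum_congr rfl fun j hj => by
    rw [M.marginalProb_eq l (Nat.lt_succ_iff.1 (Finset.mem_range.1 hj))]

/-- The count zero has probability `(1 - p) ^ N`, and `1 / (1 - p) = 1 + p / (1 - p) ≤ exp (p / (1 -
p))`. -/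
theorem exp_neg_le_marginalProb_zero (M : CountSERGM k) (l : Fin k) :
    Real.exp (-(M.binMean l / (1 - M.p l))) ≤ M.marginalProb l 0 := by
  have hp1 : 0 < 1 - M.p l := by linarith [M.p_lt_one l]
  rw [M.marginalProb_eq l (Nat.zero_le _)]
  simp only [binomWeight, Nat.choose_zero_right, pow_zero, Nat.sub_zero, Nat.cast_one, one_mul]
  have h1 : Real.exp (-(M.p l / (1 - M.p l))) ≤ 1 - M.p l := by
    rw [Real.exp_neg]
    refine inv_le_of_inv_le₀ hp1 ?_
    have := Real.add_one_le_exp (M.p l / (1 - M.p l))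
    refine le_trans (le_of_eq ?_) this
    field_simp
    ring
  refine le_trans (le_of_eq ?_) (pow_le_pow_left₀ (Real.exp_pos _).le h1 (M.Smax l))
  rw [← Real.exp_nat_mul, binMean]
  congr 1
  ring

end CountSERGM

open CountSERGM

/-! ### Asymptotics along a sequence of count SERGMs -/

theorem CountSERGM.binMean_nonneg (M : CountSERGM k) (l : Fin k) : 0 ≤ M.binMean l :=
  mul_nonneg (Nat.cast_nonneg _) (M.p_pos l).le

theorem NonConflicted.exists_eventually_window {M : ℕ → CountSERGM k} (hM : NonConflicted M) :
    ∃ ε : ℝ, 0 < ε ∧ ε ≤ 1 / 2 ∧ ∀ᶠ n in atTop,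
      (∀ l, (M n).binMean l * (1 + ε) ≤ (M n).Smax l) ∧
      ∀ s : Fin k → ℕ, (∀ l, |(s l : ℝ) - (M n).binMean l| ≤ ε * (M n).binMean l) →
        s ∈ (M n).A := by
  obtain ⟨ε₀, hε₀, hA⟩ := hM
  refine ⟨min ε₀ (1 / 2), by positivity, min_le_right _ _, ?_⟩
  filter_upwards [hA] with n hn
  set ε := min ε₀ (1 / 2)
  have h1 : ε ≤ ε₀ := min_le_left _ _
  have hE := (M n).binMean_nonneg
  refine ⟨fun l => ?_, fun s hs => hn s fun l => ?_⟩
  -- The upper corner of the integer window is feasible, hence bounded by the maximal counts.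
  · set s : Fin k → ℕ := fun l => ⌈(M n).binMean l * (1 + ε₀)⌉₊
    have hmem : s ∈ (M n).A := hn s fun l => by
      have hc : ((s l : ℕ) : ℤ) = ⌈(M n).binMean l * (1 + ε₀)⌉ :=
        Int.natCast_ceil_eq_ceil (mul_nonneg (hE l) (by linarith))
      rw [marginalMean_eq, hc]
      exact ⟨(Int.floor_le_ceil _).trans
        (Int.ceil_le_ceil (mul_le_mul_of_nonneg_left (by linarith) (hE l))), le_rfl⟩
    have h2 : (s l : ℝ) ≤ (M n).Smax l := by exact_mod_cast (M n).le_Smax s hmem l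
    have h3 : (M n).binMean l * (1 + ε₀) ≤ s l := Nat.le_ceil _
    have h4 : (M n).binMean l * (1 + ε) ≤ (M n).binMean l * (1 + ε₀) :=
      mul_le_mul_of_nonneg_left (by linarith) (hE l)
    linarith
  · have h2 := abs_le.1 (hs l)
    have h3 : ε * (M n).binMean l ≤ ε₀ * (M n).binMean l := mul_le_mul_of_nonneg_right h1 (hE l)
    rw [marginalMean_eq]
    constructor
    · have : ((⌊(M n).binMean l * (1 - ε₀)⌋ : ℤ) : ℝ) ≤ ((s l : ℤ) : ℝ) := by
        refine (Int.floor_le _).trans ?_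
        push_cast
        linarith
      exact_mod_cast this
    · have : ((s l : ℤ) : ℝ) ≤ ((⌈(M n).binMean l * (1 + ε₀)⌉ : ℤ) : ℝ) := by
        refine le_trans ?_ (Int.le_ceil _)
        push_cast
        linarith
      exact_mod_cast this

theorem NonConflicted.exists_eventually_hasWindow {M : ℕ → CountSERGM k} (hM : NonConflicted M)
    (hE : ∀ l, Tendsto (fun n => (M n).binMean l) atTop atTop) :
    ∃ ε, 0 < ε ∧ ∀ᶠ n in atTop, (M n).HasWindow ε := by
  obtain ⟨ε, hε, hε2, h⟩ := hM.exists_eventually_window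
  refine ⟨ε, hε, ?_⟩
  filter_upwards [h, eventually_all.2 fun l => (hE l).eventually_gt_atTop 0] with n hn hpos
  exact ⟨hε, hε2, hpos, hn.1, hn.2⟩

/-- If the probability of the count zero vanishes, `binMean / (1 - p)` diverges; the window bounds
`1 - p` below by `ε / 2`, so the mean itself diverges. -/
theorem tendsto_binMean_of_extremesNegligible {M : ℕ → CountSERGM k} (hM : NonConflicted M)
    (hS : ∀ l, Tendsto (fun n => (M n).Smax l) atTop atTop) (hX : ExtremesNegligible M)
    (l : Fin k) : Tendsto (fun n => (M n).binMean l) atTop atTop := by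
  obtain ⟨ε, hε, hε2, h⟩ := hM.exists_eventually_window
  rw [tendsto_atTop]
  intro B
  filter_upwards [h, (hS l).eventually_gt_atTop 0,
    (hX l).1.eventually_lt_const (Real.exp_pos (-(B * (2 / ε))))] with n hn hSn hlt
  have h1 := ((M n).exp_neg_le_marginalProb_zero l).trans_lt hlt
  rw [Real.exp_lt_exp, neg_lt_neg_iff] at h1
  have hp : ε / 2 ≤ 1 - (M n).p l := by
    have h2 := hn.1 l
    unfold binMean at h2
    rw [mul_assoc] at h2
    have h3 : (M n).p l * (1 + ε) ≤ 1 :=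
      le_of_mul_le_mul_left (h2.trans_eq (mul_one _).symm) (by exact_mod_cast hSn)
    nlinarith [(M n).p_pos l]
  have h2 : (M n).binMean l / (1 - (M n).p l) ≤ (M n).binMean l / (ε / 2) :=
    div_le_div_of_nonneg_left ((M n).binMean_nonneg l) (by positivity) hp
  have h3 : (M n).binMean l / (ε / 2) = (M n).binMean l * (2 / ε) := by field_simp
  rw [h3] at h2
  exact (lt_of_mul_lt_mul_right (h1.trans_le h2) (by positivity)).le

theorem tendsto_scale {M : ℕ → CountSERGM k}
    (hE : ∀ l, Tendsto (fun n => (M n).binMean l) atTop atTop) (l : Fin k) :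
    Tendsto (fun n => (M n).scale l) atTop atTop :=
  (tendsto_rpow_atTop (by norm_num : (0 : ℝ) < 1 / 6)).comp (hE l)

theorem tendsto_binVar {M : ℕ → CountSERGM k} (hM : NonConflicted M)
    (hE : ∀ l, Tendsto (fun n => (M n).binMean l) atTop atTop) (l : Fin k) :
    Tendsto (fun n => (M n).binVar l) atTop atTop := by
  obtain ⟨ε, hε, hW⟩ := hM.exists_eventually_hasWindow hE
  refine tendsto_atTop_mono' _ ?_ ((hE l).const_mul_atTop (half_pos hε))
  filter_upwards [hW] with n hn using hn.le_var l

theorem tendsto_sum_div_binMean {M : ℕ → CountSERGM k}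
    (hE : ∀ l, Tendsto (fun n => (M n).binMean l) atTop atTop) {ε : ℝ} (hε : 0 < ε) :
    Tendsto (fun n => ∑ l, 8 / (ε ^ 2 * (M n).binMean l)) atTop (𝓝 0) := by
  rw [← Finset.sum_const_zero (s := (Finset.univ : Finset (Fin k)))]
  exact tendsto_finsetSum _ fun l _ =>
    ((hE l).const_mul_atTop (by positivity)).const_div_atTop 8

theorem tendsto_feasMass {M : ℕ → CountSERGM k} (hM : NonConflicted M)
    (hE : ∀ l, Tendsto (fun n => (M n).binMean l) atTop atTop) :
    Tendsto (fun n => (M n).feasMass (M n).β) atTop (𝓝 1) := by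
  obtain ⟨ε, hε, hW⟩ := hM.exists_eventually_hasWindow hE
  refine tendsto_of_tendsto_of_tendsto_of_le_of_le'
    (by simpa using (tendsto_sum_div_binMean hE hε).const_sub 1) tendsto_const_nhds ?_
    (Eventually.of_forall fun n => (M n).feasMass_le_one _)
  filter_upwards [hW] with n hn
  exact hn.feasMass_ge fun l => by simpa using (by positivity : 0 ≤ ε / 4)

theorem tendsto_law_typical_compl {M : ℕ → CountSERGM k} (hM : NonConflicted M)
    (hE : ∀ l, Tendsto (fun n => (M n).binMean l) atTop atTop) :
    Tendsto (fun n => (M n).law (M n).typicalᶜ) atTop (𝓝 0) := by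
  have h1 : Tendsto (fun n => ∑ l, 1 / (M n).scale l ^ 2) atTop (𝓝 0) := by
    rw [← Finset.sum_const_zero (s := (Finset.univ : Finset (Fin k)))]
    exact tendsto_finsetSum _ fun l _ =>
      ((tendsto_pow_atTop two_ne_zero).comp (tendsto_scale hE l)).const_div_atTop 1
  have h2 := ENNReal.tendsto_ofReal (h1.div (tendsto_feasMass hM hE) one_ne_zero)
  rw [zero_div, ENNReal.ofReal_zero] at h2
  refine tendsto_of_tendsto_of_tendsto_of_le_of_le' tendsto_const_nhds h2
    (Eventually.of_forall fun n => zero_le) ?_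
  filter_upwards [eventually_all.2 fun l => (hE l).eventually_gt_atTop 0] with n hn
  exact (M n).law_typical_compl_le hn

/-- For typical counts, uniformly, there is exactly one maximum likelihood estimate, and it is
approximated by the direct estimator, which satisfies a linear expansion. -/
theorem eventually_forall_typical {M : ℕ → CountSERGM k} (hM : NonConflicted M)
    (hE : ∀ l, Tendsto (fun n => (M n).binMean l) atTop atTop) {δ : ℝ} (hδ : 0 < δ) :
    ∀ᶠ n in atTop, ∀ s ∈ (M n).typical, s ∈ (M n).A ∧ (∃! b, (M n).IsMLEAt s b) ∧
      ∀ l, 0 < s l ∧ s l < (M n).Smax l ∧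
        |directEst ((M n).Smax l) (s l) - (M n).β l| ≤ δ ∧
        |√((M n).binVar l) * (directEst ((M n).Smax l) (s l) - (M n).β l)
          - ((s l : ℝ) - (M n).binMean l) / √((M n).binVar l)| ≤ δ ∧
        ∀ b, (M n).IsMLEAt s b →
          √((M n).binVar l) * |b l - directEst ((M n).Smax l) (s l)| ≤ δ := by
  obtain ⟨ε, hε, hW⟩ := hM.exists_eventually_hasWindow hE
  set C : ℝ := 2 * (1 + 1 / ε ^ 2) + 2 / ε
  set r : ℝ := min δ 1
  have hr : 0 < r := by positivity
  filter_upwards [hW, eventually_all.2 fun l => (tendsto_scale hE l).eventually_ge_atTop 1,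
    eventually_all.2 fun l => ((tendsto_pow_atTop two_ne_zero).comp
      (tendsto_scale hE l)).eventually_ge_atTop (8 / ε),
    eventually_all.2 fun l => ((tendsto_scale hE l).const_div_atTop C).eventually_le_const hδ,
    eventually_all.2 fun l => ((tendsto_scale hE l).const_div_atTop C).eventually_le_const
      (by positivity : 0 < ε / 8),
    eventually_all.2 fun l => ((hE l).const_mul_atTop hε).eventually_ge_atTop 2,
    (tendsto_sum_div_binMean hE hε).eventually_le_const (by positivity : 0 < r ^ 2 / 32),
    eventually_all.2 fun l => ((Real.tendsto_sqrt_atTop.comp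
      (tendsto_binVar hM hE l)).const_div_atTop r).eventually_le_const
      (by positivity : 0 < ε / 8)] with n hn hu1 hu hCδ hCε hEn hsum hd s hs
  have hnear := fun l => hn.directEst_near (hu1 l) (hu l) (hs l)
  obtain ⟨hex, hloc⟩ := hn.mle_of_near hr (min_le_right _ _) hEn hsum hd
    (fun l => ⟨(hnear l).2.1, (hnear l).2.2.1⟩) (fun l => (hnear l).1)
    (fun l => (hnear l).2.2.2.1.trans (hCε l))
  refine ⟨hn.mem s fun l => (hnear l).1.trans ?_, hex, fun l => ⟨(hnear l).2.1, (hnear l).2.2.1,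
    (hnear l).2.2.2.1.trans (hCδ l), (hnear l).2.2.2.2.trans (hCδ l),
    fun b hb => (hloc b hb l).trans (min_le_left _ _)⟩⟩
  exact mul_le_mul_of_nonneg_right (by linarith) (hn.mean_pos l).le

theorem tendsto_law_one {M : ℕ → CountSERGM k} (hM : NonConflicted M)
    (hE : ∀ l, Tendsto (fun n => (M n).binMean l) atTop atTop) {B : ℕ → Set (Fin k → ℕ)}
    (hB : ∀ᶠ n in atTop, (M n).typical ⊆ B n) :
    Tendsto (fun n => (M n).law (B n)) atTop (𝓝 1) := by
  have h := ENNReal.Tendsto.sub (tendsto_const_nhds (x := (1 : ENNReal)) (f := atTop))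
    (tendsto_law_typical_compl hM hE) (Or.inl ENNReal.one_ne_top)
  rw [tsub_zero] at h
  refine tendsto_of_tendsto_of_tendsto_of_le_of_le' h tendsto_const_nhds ?_
    (Eventually.of_forall fun n => prob_le_one)
  filter_upwards [hB] with n hn
  rw [← prob_compl_eq_one_sub .of_discrete, compl_compl]
  exact measure_mono hn

theorem tendsto_law_zero {M : ℕ → CountSERGM k} (hM : NonConflicted M)
    (hE : ∀ l, Tendsto (fun n => (M n).binMean l) atTop atTop) {B : ℕ → Set (Fin k → ℕ)}
    (hB : ∀ᶠ n in atTop, ∀ s ∈ (M n).typical, s ∉ B n) :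
    Tendsto (fun n => (M n).law (B n)) atTop (𝓝 0) := by
  refine tendsto_of_tendsto_of_tendsto_of_le_of_le' tendsto_const_nhds
    (tendsto_law_typical_compl hM hE) (Eventually.of_forall fun n => zero_le) ?_
  filter_upwards [hB] with n hn
  exact measure_mono fun s hs hst => hn s hst hs

/-! ### Asymptotic normality -/

/-- The characteristic functions of the standardized statistics converge to that of the standard
normal distribution. -/
theorem tendsto_integral_cexp_standardized {M : ℕ → CountSERGM k} (hM : NonConflicted M)
    (hE : ∀ l, Tendsto (fun n => (M n).binMean l) atTop atTop) (l : Fin k) (t : ℝ) :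
    Tendsto (fun n => ∫ s, Complex.exp ((t * (((s l : ℝ) - (M n).binMean l) /
      √((M n).binVar l)) : ℝ) * Complex.I) ∂(M n).law) atTop
      (𝓝 (Complex.exp (-(t ^ 2 / 2 : ℝ)))) := by
  have hsq : Tendsto (fun n => √((M n).binVar l)) atTop atTop :=
    Real.tendsto_sqrt_atTop.comp (tendsto_binVar hM hE l)
  have hbound : Tendsto (fun n => 2 * (1 - (M n).feasMass (M n).β)
      + 2 * |t| ^ 3 / √((M n).binVar l)) atTop (𝓝 0) := by
    have h1 := ((tendsto_feasMass hM hE).const_sub 1).const_mul 2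
    have h2 := h1.add (hsq.const_div_atTop (2 * |t| ^ 3))
    simpa using h2
  rw [tendsto_iff_norm_sub_tendsto_zero]
  refine squeeze_zero' (Eventually.of_forall fun n => norm_nonneg _) ?_ hbound
  filter_upwards [hsq.eventually_ge_atTop |t|, hsq.eventually_gt_atTop 0] with n hn hpos
  have hV : 0 < (M n).binVar l := Real.sqrt_pos.1 hpos
  -- This scaling makes the Gaussian exponent exactly `t ^ 2 / 2` and turns the cubic error into `2
  -- * |t| ^ 3 / √V`.
  set τ : ℝ := t / √((M n).binVar l) with hτ
  have hτ1 : |τ| ≤ 1 := by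
    rw [hτ, abs_div, abs_of_pos hpos]
    exact (div_le_one hpos).2 hn
  have h1 := norm_sum_binomWeight_cexp_sub_le (N := (M n).Smax l) ((M n).p_pos l).le
    ((M n).p_lt_one l).le hτ1
  have h2 := (M n).norm_integral_law_sub_le l
    (g := fun j => Complex.exp ((τ * ((j : ℝ) - (M n).Smax l * (M n).p l) : ℝ) * Complex.I))
    fun j => (Complex.norm_exp_ofReal_mul_I _).le
  have h3 : (M n).Smax l * (M n).p l * (1 - (M n).p l) * τ ^ 2 / 2 = t ^ 2 / 2 := by
    change (M n).binVar l * τ ^ 2 / 2 = _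
    rw [hτ, div_pow, Real.sq_sqrt hV.le]
    field_simp
  have h4 : 2 * ((M n).Smax l * (M n).p l * (1 - (M n).p l)) * |τ| ^ 3
      = 2 * |t| ^ 3 / √((M n).binVar l) := by
    change 2 * (M n).binVar l * |τ| ^ 3 = _
    rw [hτ, abs_div, abs_of_pos hpos, div_pow]
    have : √((M n).binVar l) ^ 3 = (M n).binVar l * √((M n).binVar l) := by
      rw [pow_succ, Real.sq_sqrt hV.le]
    rw [this]
    field_simp
  rw [h3, h4] at h1
  have h5 : ∀ s : Fin k → ℕ, t * (((s l : ℝ) - (M n).binMean l) / √((M n).binVar l))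
      = τ * ((s l : ℝ) - (M n).Smax l * (M n).p l) := fun s => by
    rw [hτ, binMean]
    ring
  simp_rw [h5]
  exact (norm_sub_le_norm_sub_add_norm_sub _ _ _).trans (add_le_add h2 h1)

theorem norm_cexp_mul_I_sub_le (a b : ℝ) :
    ‖Complex.exp (a * Complex.I) - Complex.exp (b * Complex.I)‖ ≤ |a - b| := by
  have h : Complex.exp (a * Complex.I) - Complex.exp (b * Complex.I)
      = Complex.exp (b * Complex.I) * (Complex.exp (Complex.I * (a - b : ℝ)) - 1) := by
    rw [mul_sub, ← Complex.exp_add, mul_one]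
    congr 2
    push_cast
    ring
  rw [h, norm_mul, Complex.norm_exp_ofReal_mul_I, one_mul]
  exact Real.norm_exp_I_mul_ofReal_sub_one_le

/-- On `G` the map `x ↦ exp (i x)` is 1-Lipschitz; off `G` two points of the unit circle are at
distance at most 2. -/
theorem norm_integral_cexp_sub_le {Ω : Type*} [MeasurableSpace Ω] [DiscreteMeasurableSpace Ω]
    (μ : Measure Ω) [IsProbabilityMeasure μ] {X Y : Ω → ℝ} (G : Set Ω) {c : ℝ} (hc : 0 ≤ c)
    (h : ∀ s ∈ G, |Y s - X s| ≤ c) :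
    ‖∫ s, Complex.exp (Y s * Complex.I) ∂μ - ∫ s, Complex.exp (X s * Complex.I) ∂μ‖
      ≤ c + 2 * μ.real Gᶜ := by
  have hint : ∀ Z : Ω → ℝ, Integrable (fun s => Complex.exp (Z s * Complex.I)) μ := fun Z =>
    Integrable.of_bound (Measurable.of_discrete.aestronglyMeasurable) 1
      (ae_of_all _ fun s => (Complex.norm_exp_ofReal_mul_I _).le)
  have hb : Integrable (fun s => c + Gᶜ.indicator (fun _ => (2 : ℝ)) s) μ :=
    (integrable_const c).add ((integrable_const (2 : ℝ)).indicator .of_discrete)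
  rw [← integral_sub (hint Y) (hint X)]
  refine (norm_integral_le_of_norm_le hb (ae_of_all _ fun s => ?_)).trans (le_of_eq ?_)
  · by_cases hs : s ∈ G
    · simpa [hs] using (norm_cexp_mul_I_sub_le _ _).trans (h s hs)
    · have h2 := norm_sub_le (Complex.exp (Y s * Complex.I)) (Complex.exp (X s * Complex.I))
      rw [Complex.norm_exp_ofReal_mul_I, Complex.norm_exp_ofReal_mul_I] at h2
      rw [Set.indicator_of_mem hs]
      linarith
  · rw [integral_add (integrable_const c) ((integrable_const (2 : ℝ)).indicator .of_discrete),
      integral_indicator_const _ .of_discrete]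
    simp [mul_comm]

/-- A Slutsky argument on characteristic functions: closeness to the standardized count is needed
only on typical counts, and Lévy's continuity theorem concludes. -/
theorem tendstoInDistribution_of_abs_sub_le {M : ℕ → CountSERGM k} (hM : NonConflicted M)
    (hE : ∀ l, Tendsto (fun n => (M n).binMean l) atTop atTop) (l : Fin k)
    (Y : ℕ → (Fin k → ℕ) → ℝ)
    (hY : ∀ δ : ℝ, 0 < δ → ∀ᶠ n in atTop, ∀ s ∈ (M n).typical,
      |Y n s - ((s l : ℝ) - (M n).binMean l) / √((M n).binVar l)| ≤ δ) :
    TendstoInDistribution Y atTop (id : ℝ → ℝ) (fun n => (M n).law) (gaussianReal 0 1) where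
  forall_aemeasurable n := Measurable.of_discrete.aemeasurable
  aemeasurable_limit := aemeasurable_id
  tendsto := by
    refine ProbabilityMeasure.tendsto_iff_tendsto_charFun.2 fun t => ?_
    simp only [ProbabilityMeasure.coe_mk, Measure.map_id, charFun_gaussianReal]
    have hchar : ∀ n, charFun ((M n).law.map (Y n)) t
        = ∫ s, Complex.exp ((t * Y n s : ℝ) * Complex.I) ∂(M n).law := fun n => by
      rw [charFun_apply_real, integral_map Measurable.of_discrete.aemeasurable (by fun_prop)]
      push_cast
      rfl
    simp_rw [hchar]
    have hreal : Tendsto (fun n => (M n).law.real (M n).typicalᶜ) atTop (𝓝 0) := by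
      have h := (ENNReal.tendsto_toReal ENNReal.zero_ne_top).comp
        (tendsto_law_typical_compl hM hE)
      rwa [ENNReal.toReal_zero] at h
    have hdiff : Tendsto (fun n => ∫ s, Complex.exp ((t * Y n s : ℝ) * Complex.I) ∂(M n).law
        - ∫ s, Complex.exp ((t * (((s l : ℝ) - (M n).binMean l) /
          √((M n).binVar l)) : ℝ) * Complex.I) ∂(M n).law) atTop (𝓝 0) := by
      rw [Metric.tendsto_nhds]
      intro η hη
      -- The error is `η / 4` on typical counts plus less than `2 * (η / 4)` off them; the `+ 1`
      -- covers `t = 0`.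
      have hδ : 0 < η / 4 / (|t| + 1) := by positivity
      filter_upwards [hY _ hδ, hreal.eventually_lt_const (by positivity : 0 < η / 4)] with n hn hl
      rw [dist_zero_right]
      refine (norm_integral_cexp_sub_le (M n).law (M n).typical (c := η / 4) (by positivity)
        fun s hs => ?_).trans_lt (by linarith)
      rw [← mul_sub, abs_mul]
      calc |t| * _ ≤ (|t| + 1) * (η / 4 / (|t| + 1)) :=
            mul_le_mul (by linarith) (hn s hs) (abs_nonneg _) (by positivity)
        _ = η / 4 := by field_simp
    have := hdiff.add (tendsto_integral_cexp_standardized hM hE l t)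
    simp only [sub_add_cancel, zero_add] at this
    convert this using 2
    congr 1
    push_cast
    ring

theorem CountSERGM.sqrt_div_sqrt_var {M : CountSERGM k} (l : Fin k) (x : ℝ) :
    √(M.Smax l : ℝ) * x / √(1 / (M.p l * (1 - M.p l))) = √(M.binVar l) * x := by
  have h : 0 < M.p l * (1 - M.p l) :=
    mul_pos (M.p_pos l) (by linarith [M.p_lt_one l])
  rw [binVar, mul_assoc, Real.sqrt_mul (Nat.cast_nonneg _), one_div, Real.sqrt_inv, div_inv_eq_mul]
  ring

end

/-! ### Consistency, direct approximation and asymptotic normality -/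

open CountSERGM in
theorem theorem1 (k : ℕ) (M : ℕ → CountSERGM k)
    (hS : ∀ l, Tendsto (fun n => (M n).Smax l) atTop atTop)
    (hM : NonConflicted M)
    (est : ℕ → (Fin k → ℕ) → EuclideanSpace ℝ (Fin k))
    (hest : ∀ n, (M n).IsMLE (est n)) :
    -- with probability tending to one there is exactly one maximum likelihood estimate, the
    -- estimator is consistent, and it is approximated by the direct binomial estimator, with an
    -- error of smaller order than the asymptotic standard deviation
    (ExtremesNegligible M →
      Tendsto (fun n => (M n).law {s | ∃! b, (M n).IsMLEAt s b}) atTop (𝓝 1) ∧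
      (∀ δ : ℝ, 0 < δ →
        Tendsto (fun n => (M n).law {s | δ ≤ ‖est n s - (M n).β‖}) atTop (𝓝 0)) ∧
      (∀ l, ∀ δ : ℝ, 0 < δ →
        Tendsto (fun n => (M n).law {s | 0 < s l ∧ s l < (M n).Smax l ∧
          √((M n).Smax l : ℝ) *
            |est n s l - Real.log ((s l : ℝ) / (((M n).Smax l : ℝ) - (s l : ℝ)))|
              < δ * √(1 / ((M n).p l * (1 - (M n).p l)))}) atTop (𝓝 1))) ∧
    -- asymptotic normality with variance `1 / (p (1 - p))`
    ((∀ l, Tendsto (fun n => (M n).p l * ((M n).Smax l : ℝ)) atTop atTop) →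
      ∀ l, TendstoInDistribution
        (fun n s => √((M n).Smax l : ℝ) * (est n s l - (M n).β l) /
          √(1 / ((M n).p l * (1 - (M n).p l))))
        atTop (id : ℝ → ℝ) (fun n => (M n).law) (gaussianReal 0 1)) := by
  refine ⟨fun hX => ?_, fun hpS l => ?_⟩
  · have hE := fun l => tendsto_binMean_of_extremesNegligible hM hS hX l
    refine ⟨tendsto_law_one hM hE ?_, fun δ hδ => tendsto_law_zero hM hE ?_,
      fun l δ hδ => tendsto_law_one hM hE ?_⟩
    · filter_upwards [eventually_forall_typical hM hE one_pos] with n hn s hs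
      exact (hn s hs).2.1
    -- Each coordinate contributes at most twice this amount, once from the direct estimator and
    -- once from the gap to it, so the norm stays below `δ`; `k + 1` also covers `k = 0`.
    · have hδ' : 0 < δ / (4 * (k + 1)) := by positivity
      filter_upwards [eventually_forall_typical hM hE hδ', eventually_all.2 fun l =>
        (tendsto_binVar hM hE l).eventually_ge_atTop 1] with n hn hV s hs
      obtain ⟨hA, hex, h⟩ := hn s hs
      have hb := hest n s hA hex.exists
      have hcoord : ∀ l, |est n s l - (M n).β l| ≤ 2 * (δ / (4 * (k + 1))) := fun l => by
        obtain ⟨-, -, h1, -, h2⟩ := h l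
        have h3 : |est n s l - directEst ((M n).Smax l) (s l)| ≤ δ / (4 * (k + 1)) :=
          (le_mul_of_one_le_left (abs_nonneg _) (Real.one_le_sqrt.2 (hV l))).trans (h2 _ hb)
        have h4 := abs_sub_le (est n s l) (directEst ((M n).Smax l) (s l)) ((M n).β l)
        linarith
      have hnorm : ‖est n s - (M n).β‖ ≤ ∑ _l : Fin k, 2 * (δ / (4 * (k + 1))) := by
        have hc : 0 ≤ 2 * (δ / (4 * (k + 1))) := by positivity
        rw [EuclideanSpace.norm_eq, Finset.sum_const, Finset.card_univ, Fintype.card_fin,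
          nsmul_eq_mul]
        refine Real.sqrt_le_iff.2 ⟨by positivity, ?_⟩
        have hk : (k : ℝ) ≤ k ^ 2 := by exact_mod_cast Nat.le_self_pow two_ne_zero k
        calc ∑ l, ‖(est n s - (M n).β) l‖ ^ 2
            ≤ ∑ _l : Fin k, (2 * (δ / (4 * (k + 1)))) ^ 2 :=
              Finset.sum_le_sum fun l _ => pow_le_pow_left₀ (norm_nonneg _) (hcoord l) 2
          _ = k * (2 * (δ / (4 * (k + 1)))) ^ 2 := by simp
          _ ≤ k ^ 2 * (2 * (δ / (4 * (k + 1)))) ^ 2 := by gcongr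
          _ = _ := by ring
      rw [Finset.sum_const, Finset.card_univ, Fintype.card_fin, nsmul_eq_mul] at hnorm
      have hlt : (k : ℝ) * (2 * (δ / (4 * (k + 1)))) < δ := by
        have : (k : ℝ) * (2 * (δ / (4 * (k + 1)))) = k / (k + 1) * (δ / 2) := by
          field_simp
          ring
        rw [this]
        have hk : (k : ℝ) / (k + 1) ≤ 1 := (div_le_one (by positivity)).2 (by linarith)
        nlinarith
      exact not_le.2 (hnorm.trans_lt hlt)
    · filter_upwards [eventually_forall_typical hM hE (half_pos hδ)] with n hn s hs
      obtain ⟨hA, hex, h⟩ := hn s hs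
      obtain ⟨h0, h1, -, -, h2⟩ := h l
      refine ⟨h0, h1, ?_⟩
      have hp : 0 < (M n).p l * (1 - (M n).p l) :=
        mul_pos ((M n).p_pos l) (by linarith [(M n).p_lt_one l])
      -- Dividing by the asymptotic standard deviation turns the normalization into `√V`; the bound
      -- `δ / 2` yields the strict inequality.
      rw [← div_lt_iff₀ (Real.sqrt_pos.2 (by positivity)), sqrt_div_sqrt_var]
      exact (h2 _ (hest n s hA hex.exists)).trans_lt (by linarith)
  · have hE : ∀ l, Tendsto (fun n => (M n).binMean l) atTop atTop := fun l => by
      simpa only [binMean, mul_comm] using hpS l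
    refine tendstoInDistribution_of_abs_sub_le hM hE l _ fun δ hδ => ?_
    filter_upwards [eventually_forall_typical hM hE (half_pos hδ)] with n hn s hs
    obtain ⟨hA, hex, h⟩ := hn s hs
    obtain ⟨-, -, -, h1, h2⟩ := h l
    have h3 := h2 _ (hest n s hA hex.exists)
    set D := directEst ((M n).Smax l) (s l)
    have h4 : √((M n).binVar l) * |est n s l - D| = |√((M n).binVar l) * (est n s l - D)| := by
      rw [abs_mul, abs_of_nonneg (Real.sqrt_nonneg _)]
    rw [sqrt_div_sqrt_var]
    have h5 : √((M n).binVar l) * (est n s l - (M n).β l)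
          - ((s l : ℝ) - (M n).binMean l) / √((M n).binVar l)
        = √((M n).binVar l) * (est n s l - D) + (√((M n).binVar l) * (D - (M n).β l)
          - ((s l : ℝ) - (M n).binMean l) / √((M n).binVar l)) := by ring
    rw [h5]
    refine (abs_add_le _ _).trans ?_
    rw [← h4]
    linarith
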